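/- Let $(X,d)$ be a compact metric space with base point $x_0\in X$, let $P(X)$ be the set of Borel probability measures on $X$, let $\mu,\nu\in P(X)$, $\lambda>0$ and $\alpha\ge 1$. Let $\phi:\mathbb R\to\overline{\mathbb R}$ be proper, convex and lower semicontinuous, with $\phi(1)=0$, with $1$ in the relative interior of $\operatorname{dom}\phi=\{x:\phi(x)<\infty\}$, and strictly convex at $1$, i.e. $\phi(1)<t\phi(x_1)+(1-t)\phi(x_2)$ whenever $t\in(0,1)$, $x_1,x_2\in\operatorname{dom}\phi$, $tx_1+(1-t)x_2=1$ and not $x_1=x_2=1$. For $\xi\in P(X)$ with Lebesgue decomposition $\xi=\xi_c+\xi_s$, $\xi_c\ll\nu$, $\xi_s\perp\nu$, put $$D_\phi(\xi\Vert\nu)=\int\phi\Big(\frac{d\xi_c}{d\nu}\Big)\,d\nu+\phi'(\infty)\,\xi_s(X)\in(-\infty,\infty],\qquad \phi'(\infty)=\lim_{x\to\infty}\frac{\phi(x)}{x},$$ with $\infty\cdot 0=0$. Let $W_1(\mu,\xi)=\inf_\pi\int d(x_1,x_2)\,d\pi(x_1,x_2)$, the infimum being over the probability measures $\pi$ on $X\times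 X$ with marginals $\mu$ and $\xi$. Let $Lip(X,x_0)$ be the set of Lipschitz functions $f:X\to\mathbb R$ with $f(x_0)=0$, let $\Vert f\Vert_L=\sup_{x\ne y}\frac{|f(x)-f(y)|}{d(x,y)}$ (read as $0$ if $X$ has one point), and let $$D_\phi^*(f\Vert\nu)=\sup_{\xi\in P(X)}\Big\{\int f\,d\xi-D_\phi(\xi\Vert\nu)\Big\}.$$ Then the infimum $$D_{\phi,\lambda,\alpha}(\mu\Vert\nu)=\inf_{\xi\in P(X)}\big\{D_\phi(\xi\Vert\nu)+\lambda W_1(\mu,\xi)^\alpha\big\}$$ is attained. If $\alpha=1$, then $$D_{\phi,\lambda,1}(\mu\Vert\nu)=\max_{f\in Lip(X,x_0),\ \Vert f\Vert_L\le\lambda}\Big\{\int f\,d\mu-D_\phi^*(f\Vert\nu)\Big\},$$ and if $\alpha>1$, then $$D_{\phi,\lambda,\alpha}(\mu\Vert\nu)=\max_{f\in Lip(X,x_0)}\Big\{\int f\,d\mu-D_\phi^*(f\Vert\nu)-(\alpha-1)\,\alpha^{\frac{\alpha}{1-\alpha}}\,\lambda^{\frac{1}{1-\alpha}}\,\Vert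 f\Vert_L^{\frac{\alpha}{\alpha-1}}\Big\};$$ in both cases the maximum is attained. -/

import Mathlib

open MeasureTheory Filter
open scoped ENNReal

noncomputable section

namespace MoreauYosida

/-- The effective domain of an extended real-valued function. -/
def dom (φ : ℝ → EReal) : Set ℝ := {x | φ x < ⊤}

/-- A proper, convex and lower semicontinuous function `φ : ℝ → [-∞, ∞]`, strictly convex at `1`,
with `φ 1 = 0` and `1` in the relative interior of its effective domain.
In `EReal`, `0 * ⊤ = 0`; as `φ` never takes the value `⊥`, no sum `⊤ + ⊥` occurs below. -/
structure IsAdmissible (φ : ℝ → EReal) : Prop where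
  dom_nonempty : (dom φ).Nonempty
  ne_bot : ∀ x, φ x ≠ ⊥
  convex : ∀ x y t : ℝ, 0 ≤ t → t ≤ 1 →
    φ (t * x + (1 - t) * y) ≤ (t : EReal) * φ x + ((1 - t : ℝ) : EReal) * φ y
  lowerSemicontinuous : LowerSemicontinuous φ
  strictConvexAt_one : ∀ x₁ ∈ dom φ, ∀ x₂ ∈ dom φ, ∀ t : ℝ, 0 < t → t < 1 →
    t * x₁ + (1 - t) * x₂ = 1 → ¬ (x₁ = 1 ∧ x₂ = 1) →
    φ 1 < (t : EReal) * φ x₁ + ((1 - t : ℝ) : EReal) * φ x₂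
  map_one : φ 1 = 0
  one_mem_relint : (1 : ℝ) ∈ intrinsicInterior ℝ (dom φ)

/-- `φ'(∞) = lim_{x → ∞} φ(x) / x`. For proper convex `φ` the limit exists in `[-∞, ∞]`,
and the lower limit is then the limit. -/
def slopeAtTop (φ : ℝ → EReal) : EReal :=
  liminf (fun x : ℝ => φ x / (x : EReal)) atTop

variable {X : Type*} [MeasurableSpace X]

/-- The integral of an extended real-valued function, as the integral of its positive part minus
the integral of its negative part (meaningful when one of the two is finite). -/
def eintegral (ν : Measure X) (g : X → EReal) : EReal :=
  ((∫⁻ x, (g x).toENNReal ∂ν : ℝ≥0∞) : EReal) - ((∫⁻ x, (-g x).toENNReal ∂ν : ℝ≥0∞) : EReal)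

/-- The `f`-divergence `D_φ(μ‖ν) = ∫ φ(dμ_c/dν) dν + φ'(∞) μ_s(X)` of nonnegative measures, where
`μ = μ_c + μ_s` is the Lebesgue decomposition of `μ` with respect to `ν` (the singular part of a
nonnegative `μ` has no negative part). In `EReal`, `⊤ * 0 = 0`. -/
def fDiv (φ : ℝ → EReal) (μ ν : Measure X) : EReal :=
  eintegral ν (fun x => φ (μ.rnDeriv ν x).toReal) +
    slopeAtTop φ * ((μ.singularPart ν Set.univ : ℝ≥0∞) : EReal)

/-- The tight convex conjugate `D_φ^*(f‖ν) = sup_{ξ ∈ P(X)} {∫ f dξ - D_φ(ξ‖ν)}`. -/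
def fDivConj (φ : ℝ → EReal) (f : X → ℝ) (ν : Measure X) : EReal :=
  ⨆ ξ : ProbabilityMeasure X,
    ((∫ x, f x ∂(ξ : Measure X) : ℝ) : EReal) - fDiv φ (ξ : Measure X) ν

/-- The couplings of `μ` and `ν`: the measures on `X × X` with marginals `μ` and `ν`. -/
def couplings (μ ν : Measure X) : Set (Measure (X × X)) :=
  {π | π.map Prod.fst = μ ∧ π.map Prod.snd = ν}

variable [MetricSpace X]

/-- The Wasserstein-1 distance `W₁(μ, ν) = inf_π ∫ d(x₁, x₂) dπ(x₁, x₂)`. -/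
def W₁ (μ ν : Measure X) : ℝ≥0∞ :=
  ⨅ π ∈ couplings μ ν, ∫⁻ p, edist p.1 p.2 ∂π

/-- The function `ξ ↦ D_φ(ξ‖ν) + λ W₁(μ, ξ)^α` on `P(X)`. -/
def primalObjective (φ : ℝ → EReal) (lam α : ℝ) (μ ν : Measure X) (ξ : ProbabilityMeasure X) :
    EReal :=
  fDiv φ (ξ : Measure X) ν + ((ENNReal.ofReal lam * W₁ μ (ξ : Measure X) ^ α : ℝ≥0∞) : EReal)

/-- The Moreau-Yosida approximation `D_{φ,λ,α}(μ‖ν) = inf_{ξ ∈ P(X)} {D_φ(ξ‖ν) + λ W₁(μ, ξ)^α}`. -/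
def myDiv (φ : ℝ → EReal) (lam α : ℝ) (μ ν : Measure X) : EReal :=
  ⨅ ξ : ProbabilityMeasure X, primalObjective φ lam α μ ν ξ

end MoreauYosida

namespace MoreauYosida

/-- The space `Lip(X, x₀)` of Lipschitz continuous functions vanishing at `x₀`. -/
def LipAt {X : Type*} [MetricSpace X] (x₀ : X) : Set (X → ℝ) :=
  {f | (∃ K : NNReal, LipschitzWith K f) ∧ f x₀ = 0}

/-- The Lipschitz norm `‖f‖_L = sup_{x ≠ y} |f x - f y| / d(x, y)` of a Lipschitz function
(`0` on a one-point space, where the supremum is over the empty set). -/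
def lipNorm {X : Type*} [MetricSpace X] (f : X → ℝ) : ℝ :=
  sSup {r : ℝ | ∃ x y : X, x ≠ y ∧ r = |f x - f y| / dist x y}

end MoreauYosida

end

/-!
The divergence `D_φ(ξ‖ν)` is the supremum of `∫ h dξ - ∫ ψ dν` over pairs of continuous functions
for which `t ↦ h(x) t - ψ(x)` is an affine minorant of `φ` at every point `x`: finite maxima of
affine minorants exhaust `φ`, and a measurable choice of minorants is approximated in `L¹` by
continuous mixtures of them. Together with the conjugate description of `w ↦ λ w ^ α`, this turns
the infimum over plans starting at `μ` into a minimax problem, which is solved over the compact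
convex set of all plans with a multiplier `k` for the first marginal. Testing the dual variables
on Dirac plans gives `k(x) ≤ h(y) + r d(x, y)`, and the inf-convolution of `h` with `r d` is an
`r`-Lipschitz function between `k` and `h` that can replace both. The superlevel sets of the dual
functional are compact by Arzelà-Ascoli, so the dual supremum is attained.
-/

noncomputable section

namespace MoreauYosida

section Minimax

theorem exists_mem_stdSimplex_forall_sum_mul_pos {ι : Type*} [Fintype ι] {C : Set (ι → ℝ)}
    (hconv : Convex ℝ C) (hcomp : IsCompact C) (hne : C.Nonempty) (hC : ∀ v ∈ C, ¬ v ≤ 0) :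
    ∃ w ∈ stdSimplex ℝ ι, ∀ v ∈ C, 0 < ∑ i, w i * v i := by
  classical
  obtain ⟨f, u, v, hu, huv, hv⟩ := geometric_hahn_banach_closed_compact (convex_Iic (0 : ι → ℝ))
    isClosed_Iic hconv hcomp (Set.disjoint_left.2 fun x hx hxC => hC x hxC hx)
  have hu0 : 0 < u := by simpa using hu 0 Set.self_mem_Iic
  set w : ι → ℝ := fun i => f (Pi.single i 1) with hw
  have hf : ∀ x, f x = ∑ i, w i * x i := fun x => by
    conv_lhs => rw [pi_eq_sum_univ' x]
    simp only [map_sum, map_smul, smul_eq_mul, mul_comm, hw]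
  have hpos : ∀ x ∈ C, 0 < ∑ i, w i * x i := fun x hx => by
    rw [← hf]
    exact hu0.trans (huv.trans (hv x hx))
  have hw0 : ∀ i, 0 ≤ w i := fun i => by
    by_contra! hi
    have hmem : (u / w i) • (Pi.single i 1 : ι → ℝ) ≤ 0 :=
      smul_nonpos_of_nonpos_of_nonneg (div_nonpos_of_nonneg_of_nonpos hu0.le hi.le)
        (Pi.single_nonneg.2 zero_le_one)
    have hlt := hu _ hmem
    rw [map_smul, smul_eq_mul, div_mul_cancel₀ _ hi.ne] at hlt
    exact hlt.false
  have hW : 0 < ∑ i, w i := by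
    obtain ⟨x, hx⟩ := hne
    refine (Finset.sum_nonneg fun i _ => hw0 i).lt_of_ne fun h => (hpos x hx).ne' ?_
    have hz := (Finset.sum_eq_zero_iff_of_nonneg fun i _ => hw0 i).1 h.symm
    exact Finset.sum_eq_zero fun i hi => by rw [hz i hi, zero_mul]
  refine ⟨fun i => w i / ∑ j, w j, ⟨fun i => div_nonneg (hw0 i) hW.le, ?_⟩, fun x hx => ?_⟩
  · rw [← Finset.sum_div, div_self hW.ne']
  · simp only [div_mul_eq_mul_div, ← Finset.sum_div]
    exact div_pos (hpos x hx) hW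

variable {K V : Type*} [TopologicalSpace K] [CompactSpace K] [Nonempty K] [AddCommGroup V]
  [Module ℝ V] {S : Set V} {F : K → V → ℝ}

theorem exists_forall_lt_of_forall_exists_lt (hcont : ∀ i ∈ S, Continuous fun x => F x i)
    (hmix : ∀ x y : K, ∀ a b : ℝ, 0 ≤ a → 0 ≤ b → a + b = 1 →
      ∃ z, ∀ i, F z i = a * F x i + b * F y i)
    (hconc : ∀ x, ConcaveOn ℝ S (F x)) {c : ℝ} (h : ∀ x, ∃ i ∈ S, c < F x i) :
    ∃ j ∈ S, ∀ x, c < F x j := by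
  obtain ⟨s, hs⟩ := isCompact_univ.elim_finite_subcover (fun i : S => {x | c < F x i})
    (fun i => isOpen_lt continuous_const (hcont i i.2)) fun x _ => by
      obtain ⟨i, hi, hx⟩ := h x
      exact Set.mem_iUnion.2 ⟨⟨i, hi⟩, hx⟩
  let G : K → s → ℝ := fun x i => F x i - c
  have hG : Convex ℝ (Set.range G) := by
    rintro _ ⟨x, rfl⟩ _ ⟨y, rfl⟩ a b ha hb hab
    obtain ⟨z, hz⟩ := hmix x y a b ha hb hab
    refine ⟨z, funext fun i => ?_⟩
    simp only [G, hz, Pi.add_apply, Pi.smul_apply, smul_eq_mul]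
    linear_combination c * hab
  have hGc : Continuous G :=
    continuous_pi fun i => (hcont i i.1.2).sub continuous_const
  obtain ⟨w, ⟨hw0, hw1⟩, hw⟩ := exists_mem_stdSimplex_forall_sum_mul_pos hG
    (isCompact_range hGc) (Set.range_nonempty G) <| by
      rintro _ ⟨x, rfl⟩ hx
      obtain ⟨i, hi, hxi⟩ := Set.mem_iUnion₂.1 (hs (Set.mem_univ x))
      exact (sub_pos.2 hxi).not_ge (hx ⟨i, hi⟩)
  refine ⟨∑ i, w i • (i : V), ?_, fun x => ?_⟩
  · obtain ⟨x⟩ := ‹Nonempty K›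
    exact (hconc x).1.sum_mem (fun i _ => hw0 i) hw1 fun i _ => i.1.2
  · have hx : 0 < ∑ i, w i * (F x i - c) := hw _ ⟨x, rfl⟩
    simp only [mul_sub, Finset.sum_sub_distrib, ← Finset.sum_mul, hw1, one_mul, sub_pos] at hx
    exact hx.trans_le ((hconc x).le_map_sum (fun i _ => hw0 i) hw1 fun i _ => i.1.2)

end Minimax

/-- Closed convex functions with values in `[-∞, ∞]` that are finite somewhere, hence bounded below
by an affine function. Convexity and lower semicontinuity are those of the epigraph. -/
structure IsClosedConvex (φ : ℝ → EReal) : Prop where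
  convex_epigraph : Convex ℝ {p : ℝ × ℝ | φ p.1 ≤ p.2}
  lowerSemicontinuous : LowerSemicontinuous φ
  exists_eq_coe : ∃ t r : ℝ, φ t = r

/-- The pairs `(a, b)` such that the line `t ↦ a t - b` lies below `φ` on `[0, ∞)`. The minorants
of slope `a` are parametrised by `b`, so that this is the epigraph of the conjugate of `φ`
restricted to `[0, ∞)`. -/
def affineMinorants (φ : ℝ → EReal) : Set (ℝ × ℝ) :=
  {p | ∀ t : ℝ, 0 ≤ t → ((p.1 * t - p.2 : ℝ) : EReal) ≤ φ t}

section AffineMinorants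

variable {φ : ℝ → EReal}

theorem mem_affineMinorants_iff {p : ℝ × ℝ} :
    p ∈ affineMinorants φ ↔ ∀ t : ℝ, 0 ≤ t → ∀ r : ℝ, φ t ≤ r → p.1 * t - p.2 ≤ r :=
  ⟨fun h t ht _ hr => EReal.coe_le_coe_iff.1 ((h t ht).trans hr),
    fun h t ht => EReal.le_of_forall_lt_iff_le.1 fun r hr =>
      EReal.coe_le_coe_iff.2 (h t ht r hr.le)⟩

theorem convex_affineMinorants (φ : ℝ → EReal) : Convex ℝ (affineMinorants φ) := by
  intro p hp q hq a b ha hb hab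
  rw [mem_affineMinorants_iff] at *
  intro t ht r hr
  calc (a • p + b • q).1 * t - (a • p + b • q).2
      = a * (p.1 * t - p.2) + b * (q.1 * t - q.2) := by
        simp only [Prod.fst_add, Prod.smul_fst, Prod.snd_add, Prod.smul_snd, smul_eq_mul]
        ring
    _ ≤ a * r + b * r := by gcongr; exacts [hp t ht r hr, hq t ht r hr]
    _ = r := by rw [← add_mul, hab, one_mul]

theorem slope_le_slopeAtTop {p : ℝ × ℝ} (hp : p ∈ affineMinorants φ) :
    (p.1 : EReal) ≤ slopeAtTop φ := by
  have hlim : Tendsto (fun x : ℝ => ((p.1 - p.2 / x : ℝ) : EReal)) atTop (nhds (p.1 : EReal)) := by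
    refine (continuous_coe_real_ereal.tendsto _).comp ?_
    simpa using (tendsto_const_nhds (x := p.1)).sub
      ((tendsto_const_nhds (x := p.2)).div_atTop tendsto_id)
  rw [← hlim.liminf_eq]
  refine liminf_le_liminf ?_
  filter_upwards [eventually_gt_atTop 0] with x hx
  rw [EReal.le_div_iff_mul_le (by exact_mod_cast hx) (EReal.coe_ne_top x), ← EReal.coe_mul,
    sub_mul, div_mul_cancel₀ _ hx.ne']
  exact hp x hx.le

theorem exists_affine_of_nonvertical_separation {t₀ c α β u : ℝ} (hβ : 0 < β)
    (hu : α * t₀ + β * c < u)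
    (H : ∀ t r : ℝ, φ t ≤ r → u < α * t + β * r) :
    ∃ a b : ℝ, c < a * t₀ - b ∧ ∀ t r : ℝ, φ t ≤ r → a * t - b ≤ r := by
  have hline : ∀ t, -α / β * t - -u / β = (u - α * t) / β := fun t => by ring
  refine ⟨-α / β, -u / β, ?_, fun t r hr => ?_⟩
  · rw [hline, lt_div_iff₀ hβ]
    linarith
  · rw [hline, div_le_iff₀ hβ]
    linarith [H t r hr]

namespace IsClosedConvex

theorem exists_separation (hφ : IsClosedConvex φ) {t₀ c : ℝ} (h : (c : EReal) < φ t₀) :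
    ∃ α β u : ℝ, 0 ≤ β ∧ α * t₀ + β * c < u ∧ ∀ t r : ℝ, φ t ≤ r → u < α * t + β * r := by
  have hclosed : IsClosed {p : ℝ × ℝ | φ p.1 ≤ p.2} :=
    hφ.lowerSemicontinuous.isClosed_epigraph.preimage
      (f := fun p : ℝ × ℝ => ((p.1, (p.2 : EReal)) : ℝ × EReal))
      (continuous_fst.prodMk (continuous_coe_real_ereal.comp continuous_snd))
  obtain ⟨f, u, hu, hf⟩ := geometric_hahn_banach_point_closed hφ.convex_epigraph hclosed
    (x := (t₀, c)) (not_le.2 h)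
  have hrep : ∀ t r : ℝ, f (t, r) = f (1, 0) * t + f (0, 1) * r := fun t r => by
    have : ((t, r) : ℝ × ℝ) = t • (1, 0) + r • (0, 1) := by simp
    rw [this, map_add, map_smul, map_smul, smul_eq_mul, smul_eq_mul, mul_comm t, mul_comm r]
  have hsep : ∀ t r : ℝ, φ t ≤ r → u < f (1, 0) * t + f (0, 1) * r := fun t r hr =>
    hrep t r ▸ hf (t, r) hr
  refine ⟨f (1, 0), f (0, 1), u, ?_, hrep t₀ c ▸ hu, hsep⟩
  by_contra! hneg
  obtain ⟨t, r, htr⟩ := hφ.exists_eq_coe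
  have hmem : φ t ≤ ((max r ((u - f (1, 0) * t) / f (0, 1)) : ℝ) : EReal) :=
    htr ▸ EReal.coe_le_coe_iff.2 (le_max_left _ _)
  have hle : f (0, 1) * max r ((u - f (1, 0) * t) / f (0, 1)) ≤ u - f (1, 0) * t := by
    calc _ ≤ f (0, 1) * ((u - f (1, 0) * t) / f (0, 1)) :=
          mul_le_mul_of_nonpos_left (le_max_right _ _) hneg.le
      _ = u - f (1, 0) * t := mul_div_cancel₀ _ hneg.ne
  linarith [hsep t _ hmem]

theorem exists_affine_le (hφ : IsClosedConvex φ) :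
    ∃ a b : ℝ, ∀ t r : ℝ, φ t ≤ r → a * t - b ≤ r := by
  obtain ⟨t₀, r₀, h₀⟩ := hφ.exists_eq_coe
  obtain ⟨α, β, u, -, hu, H⟩ := hφ.exists_separation (t₀ := t₀) (c := r₀ - 1)
    (h₀ ▸ EReal.coe_lt_coe_iff.2 (sub_one_lt r₀))
  have hβ' : 0 < β := by linarith [H t₀ r₀ h₀.le]
  obtain ⟨a, b, -, hab⟩ := exists_affine_of_nonvertical_separation hβ' hu H
  exact ⟨a, b, hab⟩

theorem affineMinorants_nonempty (hφ : IsClosedConvex φ) : (affineMinorants φ).Nonempty := by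
  obtain ⟨a, b, h⟩ := hφ.exists_affine_le
  exact ⟨(a, b), mem_affineMinorants_iff.2 fun t _ => h t⟩

theorem exists_affineMinorant_gt (hφ : IsClosedConvex φ) {t₀ c : ℝ} (h : (c : EReal) < φ t₀) :
    ∃ p ∈ affineMinorants φ, c < p.1 * t₀ - p.2 := by
  obtain ⟨α, β, u, hβ, hu, H⟩ := hφ.exists_separation h
  rcases hβ.eq_or_lt with rfl | hβ
  · -- The separating line is vertical: tilt a minorant by a large multiple of it.
    obtain ⟨a, b, hab⟩ := hφ.exists_affine_le
    simp only [zero_mul, add_zero] at hu H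
    obtain ⟨k, hk⟩ := exists_nat_gt ((c - (a * t₀ - b)) / (u - α * t₀))
    rw [div_lt_iff₀ (sub_pos.2 hu)] at hk
    refine ⟨(a - k * α, b - k * u), mem_affineMinorants_iff.2 fun t _ r hr => ?_, ?_⟩
    · have := mul_le_mul_of_nonneg_left (H t r hr).le k.cast_nonneg
      linarith [hab t r hr]
    · linarith
  · obtain ⟨a, b, hc, hab⟩ := exists_affine_of_nonvertical_separation hβ hu H
    exact ⟨(a, b), mem_affineMinorants_iff.2 fun t _ => hab t, hc⟩

theorem exists_affineMinorant_slope_ge (hφ : IsClosedConvex φ) {c : ℝ}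
    (h : (c : EReal) < slopeAtTop φ) : ∃ p ∈ affineMinorants φ, c ≤ p.1 := by
  obtain ⟨T, hT⟩ := eventually_atTop.1 ((eventually_lt_of_lt_liminf h).and (eventually_gt_atTop 0))
  have hT0 : 0 < T := (hT T le_rfl).2
  obtain ⟨a, b, hab⟩ := hφ.exists_affine_le
  refine ⟨(c, |b| + |c - a| * T), mem_affineMinorants_iff.2 fun t ht r hr => ?_, le_rfl⟩
  rcases le_total T t with htT | htT
  · obtain ⟨hlt, ht0⟩ := hT t htT
    rw [EReal.lt_div_iff (by exact_mod_cast ht0) (EReal.coe_ne_top t)] at hlt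
    have hct : c * t < r := by exact_mod_cast hlt.trans_le hr
    have : 0 ≤ |b| + |c - a| * T := by positivity
    linarith
  · have hdiff : (c - a) * t ≤ |c - a| * T :=
      mul_le_mul (le_abs_self _) htT ht (abs_nonneg _)
    linarith [hab t r hr, le_abs_self b]

theorem exists_seq_affineMinorants (hφ : IsClosedConvex φ) :
    ∃ s : ℕ → ℝ × ℝ, (∀ n, s n ∈ affineMinorants φ) ∧
      (∀ t : ℝ, 0 ≤ t → φ t = ⨆ n, (((s n).1 * t - (s n).2 : ℝ) : EReal)) ∧
      slopeAtTop φ = ⨆ n, ((s n).1 : EReal) := by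
  have := hφ.affineMinorants_nonempty.to_subtype
  have hdense := TopologicalSpace.denseRange_denseSeq (affineMinorants φ)
  have hsup : ∀ l : ℝ × ℝ → ℝ, Continuous l →
      ⨆ n, (l (TopologicalSpace.denseSeq (affineMinorants φ) n) : EReal)
        = ⨆ p : affineMinorants φ, (l p : EReal) := fun l hl => by
    rw [← Dense.ciSup' (f := fun p : affineMinorants φ => (l p : EReal)) hdense
      (continuous_coe_real_ereal.comp (hl.comp continuous_subtype_val)),
      iSup_range' (fun p : affineMinorants φ => (l p : EReal))]
  refine ⟨fun n => TopologicalSpace.denseSeq (affineMinorants φ) n, fun n => Subtype.coe_prop _,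
    fun t ht => ?_, ?_⟩
  · rw [hsup (fun p => p.1 * t - p.2) (by fun_prop)]
    refine le_antisymm (EReal.ge_of_forall_gt_iff_ge.1 fun c hc => ?_)
      (iSup_le fun p => p.2 t ht)
    obtain ⟨p, hp, hcp⟩ := hφ.exists_affineMinorant_gt hc
    exact le_iSup_of_le ⟨p, hp⟩ (EReal.coe_le_coe_iff.2 hcp.le)
  · rw [hsup Prod.fst continuous_fst]
    refine le_antisymm (EReal.ge_of_forall_gt_iff_ge.1 fun c hc => ?_)
      (iSup_le fun p => slope_le_slopeAtTop p.2)
    obtain ⟨p, hp, hcp⟩ := hφ.exists_affineMinorant_slope_ge hc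
    exact le_iSup_of_le ⟨p, hp⟩ (EReal.coe_le_coe_iff.2 hcp)

end IsClosedConvex

end AffineMinorants

section Eintegral

variable {X : Type*} [MeasurableSpace X] {m : Measure X}

theorem coe_integral_eq_eintegral {f : X → ℝ} (hf : Integrable f m) :
    ((∫ x, f x ∂m : ℝ) : EReal) = eintegral m fun x => (f x : EReal) := by
  have hpos : ∫⁻ x, ENNReal.ofReal (f x) ∂m ≠ ⊤ := hf.lintegral_lt_top.ne
  have hneg : ∫⁻ x, ENNReal.ofReal (-f x) ∂m ≠ ⊤ := hf.neg.lintegral_lt_top.ne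
  rw [integral_eq_lintegral_pos_part_sub_lintegral_neg_part hf, EReal.coe_sub,
    EReal.coe_ennreal_toReal hpos, EReal.coe_ennreal_toReal hneg]
  rfl

theorem eintegral_mono_ae {F G : X → EReal} (h : ∀ᵐ x ∂m, F x ≤ G x) :
    eintegral m F ≤ eintegral m G := by
  refine EReal.sub_le_sub (EReal.coe_ennreal_le_coe_ennreal_iff.2 (lintegral_mono_ae ?_))
    (EReal.coe_ennreal_le_coe_ennreal_iff.2 (lintegral_mono_ae ?_))
  · exact h.mono fun x hx => EReal.toENNReal_le_toENNReal hx
  · exact h.mono fun x hx => EReal.toENNReal_le_toENNReal (EReal.neg_le_neg_iff.2 hx)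

theorem eintegral_const (c : EReal) :
    eintegral m (fun _ => c) = c * ((m Set.univ : ℝ≥0∞) : EReal) := by
  simp only [eintegral, lintegral_const, EReal.coe_ennreal_mul]
  rcases le_total 0 c with hc | hc
  · rw [EReal.coe_toENNReal hc, EReal.toENNReal_of_nonpos (by simpa using hc)]
    simp
  · rw [EReal.coe_toENNReal (EReal.neg_nonneg.2 hc), EReal.toENNReal_of_nonpos hc]
    simp

theorem tendsto_integral_eintegral_of_monotone {f : ℕ → X → ℝ} {F : X → EReal}
    (hf : ∀ n, Integrable (f n) m) (hmono : ∀ᵐ x ∂m, Monotone fun n => f n x)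
    (hlim : ∀ᵐ x ∂m, Tendsto (fun n => (f n x : EReal)) atTop (nhds (F x))) :
    Tendsto (fun n => ((∫ x, f n x ∂m : ℝ) : EReal)) atTop (nhds (eintegral m F)) := by
  have hpos : Tendsto (fun n => ∫⁻ x, ((f n x : EReal)).toENNReal ∂m) atTop
      (nhds (∫⁻ x, (F x).toENNReal ∂m)) := by
    refine lintegral_tendsto_of_tendsto_of_monotone
      (fun n => (hf n).aemeasurable.coe_real_ereal.ereal_toENNReal) ?_ ?_
    · filter_upwards [hmono] with x hx i j hij
      exact EReal.toENNReal_le_toENNReal (EReal.coe_le_coe_iff.2 (hx hij))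
    · filter_upwards [hlim] with x hx
      exact (EReal.continuous_toENNReal.tendsto _).comp hx
  have hbound : ∀ n, (fun x => (-(f n x : EReal)).toENNReal)
      ≤ᵐ[m] fun x => (-(f 0 x : EReal)).toENNReal := fun n => by
    filter_upwards [hmono] with x hx
    exact EReal.toENNReal_le_toENNReal
      (EReal.neg_le_neg_iff.2 (EReal.coe_le_coe_iff.2 (hx n.zero_le)))
  have hneg : Tendsto (fun n => ∫⁻ x, (-(f n x : EReal)).toENNReal ∂m) atTop
      (nhds (∫⁻ x, (-F x).toENNReal ∂m)) := by
    refine tendsto_lintegral_of_dominated_convergence' _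
      (fun n => (hf n).neg.aemeasurable.coe_real_ereal.ereal_toENNReal) hbound
      (hf 0).neg.lintegral_lt_top.ne ?_
    filter_upwards [hlim] with x hx
    exact (EReal.continuous_toENNReal.tendsto _).comp ((continuous_neg.tendsto _).comp hx)
  have hfin : ∫⁻ x, (-F x).toENNReal ∂m ≠ ⊤ :=
    ne_top_of_le_ne_top (hf 0).neg.lintegral_lt_top.ne
      (le_of_tendsto' hneg fun n => lintegral_mono_ae (hbound n))
  simp only [fun n => coe_integral_eq_eintegral (hf n), eintegral, sub_eq_add_neg]
  refine (EReal.continuousAt_add (Or.inr ?_) (Or.inr ?_)).tendsto.comp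
    (((continuous_coe_ennreal_ereal.tendsto _).comp hpos).prodMk_nhds
      ((continuous_neg.tendsto _).comp ((continuous_coe_ennreal_ereal.tendsto _).comp hneg)))
  · simpa using hfin
  · simp

end Eintegral

section ContinuousApproximation

variable {X : Type*} [TopologicalSpace X] [TopologicalSpace.PseudoMetrizableSpace X]
  [MeasurableSpace X] [BorelSpace X] {m : Measure X}

theorem exists_continuousMap_lintegral_indicator_sub_le [IsFiniteMeasure m] {A : Set X}
    (hA : MeasurableSet A) {ε : ℝ≥0∞} (hε : ε ≠ 0) :
    ∃ u : C(X, ℝ), (∀ x, u x ∈ Set.Icc (0 : ℝ) 1) ∧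
      ∫⁻ x, ‖A.indicator (fun _ => (1 : ℝ)) x - u x‖ₑ ∂m ≤ ε := by
  let := TopologicalSpace.pseudoMetrizableSpacePseudoMetric X
  have hint : Integrable (A.indicator fun _ => (1 : ℝ)) m := (integrable_const 1).indicator hA
  obtain ⟨g, hg, -⟩ := hint.exists_boundedContinuous_lintegral_sub_le hε
  refine ⟨⟨fun x => Set.projIcc (0 : ℝ) 1 zero_le_one (g x), by fun_prop⟩,
    fun x => Subtype.coe_prop _, (lintegral_mono fun x => ?_).trans hg⟩
  have hmem : A.indicator (fun _ => (1 : ℝ)) x ∈ Set.Icc (0 : ℝ) 1 := by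
    by_cases hx : x ∈ A <;> simp [hx]
  have hproj := Set.abs_projIcc_sub_projIcc (c := A.indicator (fun _ => (1 : ℝ)) x) (d := g x)
    (zero_le_one (α := ℝ))
  rw [Set.projIcc_of_mem _ hmem] at hproj
  exact enorm_le_iff_norm_le.2 hproj

theorem enorm_max_sub_mix (a b u : ℝ) :
    ‖max a b - (u * a + (1 - u) * b)‖ₑ = ‖a - b‖ₑ * ‖(if b ≤ a then 1 else 0) - u‖ₑ := by
  rw [← enorm_mul]
  split_ifs with h
  · rw [max_eq_left h]
    ring_nf
  · rw [max_eq_right (not_le.1 h).le]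
    ring_nf

theorem exists_continuousMap_mix_close_max {g g' : X → ℝ} (hg : Measurable g)
    (hg' : Measurable g') (hgi : Integrable g m) (hgi' : Integrable g' m) {ε : ℝ≥0∞}
    (hε : ε ≠ 0) :
    ∃ u : C(X, ℝ), (∀ x, u x ∈ Set.Icc (0 : ℝ) 1) ∧
      ∫⁻ x, ‖max (g x) (g' x) - (u x * g x + (1 - u x) * g' x)‖ₑ ∂m ≤ ε := by
  have : IsFiniteMeasure (m.withDensity fun x => ‖g x - g' x‖ₑ) :=
    isFiniteMeasure_withDensity (hgi.sub hgi').2.ne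
  have hA : MeasurableSet {x | g' x ≤ g x} := measurableSet_le hg' hg
  obtain ⟨u, hu, hum⟩ := exists_continuousMap_lintegral_indicator_sub_le
    (m := m.withDensity fun x => ‖g x - g' x‖ₑ) hA hε
  refine ⟨u, hu, le_trans (le_of_eq ?_) hum⟩
  have hmeas : Measurable fun x => ‖{x | g' x ≤ g x}.indicator (fun _ => (1 : ℝ)) x - u x‖ₑ :=
    ((measurable_const.indicator hA).sub u.continuous.measurable).enorm
  rw [lintegral_withDensity_eq_lintegral_mul _ (by fun_prop) hmeas]
  exact lintegral_congr fun x => enorm_max_sub_mix _ _ _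

end ContinuousApproximation

/-- The pairs of continuous functions whose values are affine minorants of `φ` on `[0, ∞)`: the
dual variables in the variational formula for the divergence. -/
def dualPairs (X : Type*) [TopologicalSpace X] (φ : ℝ → EReal) : Set (C(X, ℝ) × C(X, ℝ)) :=
  {d | ∀ x, (d.1 x, d.2 x) ∈ affineMinorants φ}

theorem convex_dualPairs (X : Type*) [TopologicalSpace X] (φ : ℝ → EReal) :
    Convex ℝ (dualPairs X φ) := fun _ hd _ he _ _ ha hb hab x =>
  convex_affineMinorants φ (hd x) (he x) ha hb hab

section Compact

variable {X : Type*} [TopologicalSpace X] [CompactSpace X] [MeasurableSpace X] [BorelSpace X]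
  {m : Measure X}

theorem integrable_continuousMap (f : C(X, ℝ)) (m : Measure X) [IsFiniteMeasure m] :
    Integrable f m :=
  f.continuous.integrable_of_hasCompactSupport (HasCompactSupport.of_compactSpace f)

theorem integrable_continuousMap_mul (f : C(X, ℝ)) {k : X → ℝ} (hk : Integrable k m) :
    Integrable (fun x => f x * k x) m :=
  hk.bdd_mul f.continuous.aestronglyMeasurable (ae_of_all _ f.norm_coe_le_norm)

variable {φ : ℝ → EReal} {p q : X → ℝ} {s : ℕ → ℝ × ℝ}

theorem exists_dualPairs_close_partialSups [TopologicalSpace.PseudoMetrizableSpace X]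
    (hp : Measurable p) (hq : Measurable q) (hpi : Integrable p m)
    (hqi : Integrable q m) (hs : ∀ n, s n ∈ affineMinorants φ) (n : ℕ) {ε : ℝ≥0∞} (hε : ε ≠ 0) :
    ∃ d ∈ dualPairs X φ,
      ∫⁻ x, ‖partialSups (fun i x => (s i).1 * p x - (s i).2 * q x) n x
        - (d.1 x * p x - d.2 x * q x)‖ₑ ∂m ≤ ε := by
  induction n generalizing ε with
  | zero =>
    exact ⟨(ContinuousMap.const X (s 0).1, ContinuousMap.const X (s 0).2), fun _ => hs 0, by simp⟩
  | succ n ih =>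
    have hε2 : ε / 2 ≠ 0 := by simpa using hε
    obtain ⟨d, hd, hdm⟩ := ih hε2
    have := d.1.continuous.measurable
    have := d.2.continuous.measurable
    let g : X → ℝ := fun x => d.1 x * p x - d.2 x * q x
    let g' : X → ℝ := fun x => (s (n + 1)).1 * p x - (s (n + 1)).2 * q x
    obtain ⟨u, hu, hum⟩ := exists_continuousMap_mix_close_max (m := m) (g := g) (g' := g')
      (by fun_prop) (by fun_prop)
      ((integrable_continuousMap_mul d.1 hpi).sub (integrable_continuousMap_mul d.2 hqi))
      ((hpi.const_mul _).sub (hqi.const_mul _)) hε2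
    have := u.continuous.measurable
    refine ⟨(u * d.1 + (1 - u) * ContinuousMap.const X (s (n + 1)).1,
      u * d.2 + (1 - u) * ContinuousMap.const X (s (n + 1)).2), fun x =>
      convex_affineMinorants φ (hd x) (hs (n + 1)) (hu x).1 (sub_nonneg.2 (hu x).2)
        (add_sub_cancel _ _), ?_⟩
    refine (lintegral_mono fun x => ?_).trans ((lintegral_add_right _ (by fun_prop)).le.trans
      ((add_le_add hdm hum).trans (ENNReal.add_halves ε).le))
    rw [partialSups_add_one, Pi.sup_apply, ← edist_eq_enorm_sub]
    refine (edist_triangle _ (max (g x) (g' x)) _).trans (add_le_add ?_ (le_of_eq ?_))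
    · rw [edist_eq_enorm_sub, enorm_le_iff_norm_le]
      exact abs_max_sub_max_le_abs _ _ _
    · rw [edist_eq_enorm_sub]
      congr 1
      simp only [ContinuousMap.add_apply, ContinuousMap.mul_apply, ContinuousMap.sub_apply,
        ContinuousMap.one_apply, ContinuousMap.const_apply, g, g']
      ring

end Compact

section Densities

variable {X : Type*} [MeasurableSpace X] {ξ ν : Measure X} {p q : X → ℝ}

/-- Densities `p` of `ξ` and `q` of `ν` with respect to the dominating measure
`ν + ξ.singularPart ν`. They turn the two terms of the divergence into one integral. -/
structure AreDensities (ξ ν : Measure X) (p q : X → ℝ) : Prop where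
  measurable_left : Measurable p
  measurable_right : Measurable q
  left_ae_eq : p =ᵐ[ν] fun x => (ξ.rnDeriv ν x).toReal
  right_ae_eq : q =ᵐ[ν] fun _ => 1
  left_ae_eq_singularPart : p =ᵐ[ξ.singularPart ν] fun _ => 1
  right_ae_eq_singularPart : q =ᵐ[ξ.singularPart ν] fun _ => 0

theorem exists_areDensities (ξ ν : Measure X) : ∃ p q : X → ℝ, AreDensities ξ ν p q := by
  classical
  obtain ⟨N, hN, hσN, hνN⟩ := Measure.mutuallySingular_singularPart ξ ν
  have hν : ∀ᵐ x ∂ν, x ∈ N := by simpa [ae_iff] using! hνN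
  have hσ : ∀ᵐ x ∂ξ.singularPart ν, x ∉ N := by simpa [ae_iff] using hσN
  refine ⟨N.piecewise (fun x => (ξ.rnDeriv ν x).toReal) 1, N.piecewise 1 0,
    (Measure.measurable_rnDeriv ξ ν).ennreal_toReal.piecewise hN measurable_const,
    measurable_const.piecewise hN measurable_const, ?_, ?_, ?_, ?_⟩
  · exact hν.mono fun x hx => by simp [hx]
  · exact hν.mono fun x hx => by simp [hx]
  · exact hσ.mono fun x hx => by simp [hx]
  · exact hσ.mono fun x hx => by simp [hx]

theorem integral_eq_integral_rnDeriv_mul_add_singularPart [IsFiniteMeasure ξ] [SigmaFinite ν]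
    {f : X → ℝ} (hf : Integrable f ξ) :
    ∫ x, f x ∂ξ
      = ∫ x, f x * (ξ.rnDeriv ν x).toReal ∂ν + ∫ x, f x ∂(ξ.singularPart ν) := by
  conv_lhs => rw [← ξ.rnDeriv_add_singularPart ν]
  rw [integral_add_measure (hf.mono_measure (Measure.withDensity_rnDeriv_le ξ ν))
      (hf.mono_measure (Measure.singularPart_le ξ ν)),
    integral_withDensity_eq_integral_toReal_smul (Measure.measurable_rnDeriv ξ ν)
      (Measure.rnDeriv_lt_top ξ ν)]
  simp only [smul_eq_mul, mul_comm]

namespace AreDensities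

theorem integrable_left [IsFiniteMeasure ξ] (h : AreDensities ξ ν p q) :
    Integrable p (ν + ξ.singularPart ν) :=
  integrable_add_measure.2 ⟨Measure.integrable_toReal_rnDeriv.congr h.left_ae_eq.symm,
    (integrable_const 1).congr h.left_ae_eq_singularPart.symm⟩

theorem integrable_right [IsFiniteMeasure ν] (h : AreDensities ξ ν p q) :
    Integrable q (ν + ξ.singularPart ν) :=
  integrable_add_measure.2 ⟨(integrable_const 1).congr h.right_ae_eq.symm,
    (integrable_zero _ _ _).congr h.right_ae_eq_singularPart.symm⟩

end AreDensities

theorem fDiv_eq_eintegral_add_eintegral (φ : ℝ → EReal) (ξ ν : Measure X) :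
    fDiv φ ξ ν = eintegral ν (fun x => φ (ξ.rnDeriv ν x).toReal) +
      eintegral (ξ.singularPart ν) fun _ => slopeAtTop φ := by
  rw [fDiv, eintegral_const]

end Densities

theorem tendsto_coe_partialSups_iSup (a : ℕ → ℝ) :
    Tendsto (fun n => (partialSups a n : EReal)) atTop (nhds (⨆ n, (a n : EReal))) := by
  have hmap : (fun n => (partialSups a n : EReal)) = partialSups fun i => (a i : EReal) := by
    funext n
    induction n with
    | zero => simp only [partialSups_zero]
    | succ n ih =>
      rw [partialSups_add_one, partialSups_add_one, ← ih, EReal.coe_strictMono.monotone.map_sup]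
  rw [hmap, ← iSup_partialSups_eq]
  exact tendsto_atTop_iSup (partialSups _).monotone

section Limit

variable {X : Type*} [MeasurableSpace X] {m : Measure X}

theorem integrable_partialSups {f : ℕ → X → ℝ} (hf : ∀ n, Integrable (f n) m) (n : ℕ) :
    Integrable (partialSups f n) m := by
  induction n with
  | zero => simpa only [partialSups_zero] using hf 0
  | succ n ih => simpa only [partialSups_add_one] using ih.sup (hf (n + 1))

theorem tendsto_integral_partialSups_eintegral {f : ℕ → X → ℝ} (hf : ∀ n, Integrable (f n) m)
    {F : X → EReal} (hF : ∀ᵐ x ∂m, ⨆ n, (f n x : EReal) = F x) :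
    Tendsto (fun n => ((∫ x, partialSups f n x ∂m : ℝ) : EReal)) atTop
      (nhds (eintegral m F)) := by
  refine tendsto_integral_eintegral_of_monotone (integrable_partialSups hf)
    (ae_of_all _ fun x i j hij => (partialSups f).monotone hij x) (hF.mono fun x hx => ?_)
  simpa only [Pi.partialSups_apply, hx] using tendsto_coe_partialSups_iSup fun n => f n x

theorem tendsto_coe_add_of_monotone {a b : ℕ → ℝ} {A B : EReal} (ha : Monotone a)
    (hb : Monotone b) (hA : Tendsto (fun n => (a n : EReal)) atTop (nhds A))
    (hB : Tendsto (fun n => (b n : EReal)) atTop (nhds B)) :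
    Tendsto (fun n => ((a n + b n : ℝ) : EReal)) atTop (nhds (A + B)) := by
  have ne_bot : ∀ {c : ℕ → ℝ} {C : EReal}, Monotone c →
      Tendsto (fun n => (c n : EReal)) atTop (nhds C) → C ≠ ⊥ := fun {c C} hc hC =>
    ne_bot_of_le_ne_bot (EReal.coe_ne_bot (c 0))
      (Monotone.ge_of_tendsto (EReal.coe_strictMono.monotone.comp hc) hC 0)
  exact (EReal.continuousAt_add (Or.inr (ne_bot hb hB)) (Or.inl (ne_bot ha hA))).tendsto.comp
    (hA.prodMk_nhds hB)

theorem AreDensities.tendsto_integral_partialSups_fDiv {φ : ℝ → EReal} {ξ ν : Measure X}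
    [IsFiniteMeasure ξ] [IsFiniteMeasure ν] {p q : X → ℝ} (h : AreDensities ξ ν p q)
    {s : ℕ → ℝ × ℝ} (hφ : ∀ t, 0 ≤ t → φ t = ⨆ n, (((s n).1 * t - (s n).2 : ℝ) : EReal))
    (hslope : slopeAtTop φ = ⨆ n, ((s n).1 : EReal)) :
    Tendsto (fun n => ((∫ x, partialSups (fun i x => (s i).1 * p x - (s i).2 * q x) n x
      ∂(ν + ξ.singularPart ν) : ℝ) : EReal)) atTop (nhds (fDiv φ ξ ν)) := by
  set M : ℕ → X → ℝ := fun i x => (s i).1 * p x - (s i).2 * q x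
  have hM : ∀ n, Integrable (M n) (ν + ξ.singularPart ν) := fun n =>
    (h.integrable_left.const_mul _).sub (h.integrable_right.const_mul _)
  have hMν : ∀ n, Integrable (M n) ν := fun n => (hM n).left_of_add_measure
  have hMσ : ∀ n, Integrable (M n) (ξ.singularPart ν) := fun n => (hM n).right_of_add_measure
  have hmono : ∀ {m : Measure X}, (∀ n, Integrable (M n) m) →
      Monotone fun n => ∫ x, partialSups M n x ∂m := fun hm i j hij =>
    integral_mono (integrable_partialSups hm i) (integrable_partialSups hm j)
      ((partialSups M).monotone hij)
  have hν : ∀ᵐ x ∂ν, ⨆ n, (M n x : EReal) = φ (ξ.rnDeriv ν x).toReal := by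
    filter_upwards [h.left_ae_eq, h.right_ae_eq] with x hp hq
    simp only [M, hp, hq, mul_one, hφ _ ENNReal.toReal_nonneg]
  have hσ : ∀ᵐ x ∂ξ.singularPart ν, ⨆ n, (M n x : EReal) = slopeAtTop φ := by
    filter_upwards [h.left_ae_eq_singularPart, h.right_ae_eq_singularPart] with x hp hq
    simp only [M, hp, hq, mul_one, mul_zero, sub_zero, hslope]
  simp only [fun n => integral_add_measure (integrable_partialSups hMν n)
    (integrable_partialSups hMσ n), fDiv_eq_eintegral_add_eintegral]
  exact tendsto_coe_add_of_monotone (hmono hMν) (hmono hMσ)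
    (tendsto_integral_partialSups_eintegral hMν hν) (tendsto_integral_partialSups_eintegral hMσ hσ)

end Limit

section Variational

variable {X : Type*} [TopologicalSpace X] [CompactSpace X] [MeasurableSpace X] [BorelSpace X]
  {φ : ℝ → EReal} {ξ ν : Measure X} [IsFiniteMeasure ξ] [IsFiniteMeasure ν] {p q : X → ℝ}

theorem AreDensities.integral_mul_sub_mul (h : AreDensities ξ ν p q) (f g : C(X, ℝ)) :
    ∫ x, (f x * p x - g x * q x) ∂(ν + ξ.singularPart ν) = ∫ x, f x ∂ξ - ∫ x, g x ∂ν := by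
  have hfi := integrable_continuousMap_mul f h.integrable_left
  have hgi := integrable_continuousMap_mul g h.integrable_right
  have hfν : ∫ x, f x * p x ∂ν = ∫ x, f x * (ξ.rnDeriv ν x).toReal ∂ν :=
    integral_congr_ae (h.left_ae_eq.mono fun x hx => by simp only [hx])
  have hfσ : ∫ x, f x * p x ∂ξ.singularPart ν = ∫ x, f x ∂ξ.singularPart ν :=
    integral_congr_ae (h.left_ae_eq_singularPart.mono fun x hx => by simp only [hx, mul_one])
  have hgν : ∫ x, g x * q x ∂ν = ∫ x, g x ∂ν :=
    integral_congr_ae (h.right_ae_eq.mono fun x hx => by simp only [hx, mul_one])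
  have hgσ : ∫ x, g x * q x ∂ξ.singularPart ν = 0 :=
    integral_eq_zero_of_ae (h.right_ae_eq_singularPart.mono fun x hx => by simp [hx])
  rw [integral_sub hfi hgi, integral_add_measure hfi.left_of_add_measure hfi.right_of_add_measure,
    integral_add_measure hgi.left_of_add_measure hgi.right_of_add_measure, hfν, hfσ, hgν, hgσ,
    add_zero,
    integral_eq_integral_rnDeriv_mul_add_singularPart (ν := ν) (integrable_continuousMap f ξ)]

theorem coe_integral_sub_integral_le_fDiv {d : C(X, ℝ) × C(X, ℝ)} (hd : d ∈ dualPairs X φ) :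
    ((∫ x, d.1 x ∂ξ - ∫ x, d.2 x ∂ν : ℝ) : EReal) ≤ fDiv φ ξ ν := by
  have hi : Integrable (fun x => d.1 x * (ξ.rnDeriv ν x).toReal - d.2 x) ν :=
    (integrable_continuousMap_mul d.1 Measure.integrable_toReal_rnDeriv).sub
      (integrable_continuousMap d.2 ν)
  have hsplit : ∫ x, d.1 x ∂ξ - ∫ x, d.2 x ∂ν
      = ∫ x, (d.1 x * (ξ.rnDeriv ν x).toReal - d.2 x) ∂ν + ∫ x, d.1 x ∂ξ.singularPart ν := by
    rw [integral_eq_integral_rnDeriv_mul_add_singularPart (ν := ν) (integrable_continuousMap d.1 ξ),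
      integral_sub (integrable_continuousMap_mul d.1 Measure.integrable_toReal_rnDeriv)
        (integrable_continuousMap d.2 ν)]
    ring
  rw [hsplit, EReal.coe_add, coe_integral_eq_eintegral hi,
    coe_integral_eq_eintegral (integrable_continuousMap d.1 _), fDiv_eq_eintegral_add_eintegral]
  exact add_le_add (eintegral_mono_ae (ae_of_all _ fun x => hd x _ ENNReal.toReal_nonneg))
    (eintegral_mono_ae (ae_of_all _ fun x => slope_le_slopeAtTop (hd x)))

theorem IsClosedConvex.exists_dualPairs_gt [TopologicalSpace.PseudoMetrizableSpace X]
    (hφ : IsClosedConvex φ) {c : ℝ} (hc : (c : EReal) < fDiv φ ξ ν) :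
    ∃ d ∈ dualPairs X φ, c < ∫ x, d.1 x ∂ξ - ∫ x, d.2 x ∂ν := by
  obtain ⟨s, hs, hφs, hslope⟩ := hφ.exists_seq_affineMinorants
  obtain ⟨p, q, h⟩ := exists_areDensities ξ ν
  have hpi := h.integrable_left
  have hqi := h.integrable_right
  obtain ⟨n, hn⟩ := ((h.tendsto_integral_partialSups_fDiv hφs hslope).eventually_const_lt
    hc).exists
  set M := partialSups fun i x => (s i).1 * p x - (s i).2 * q x
  have hgap : 0 < ∫ x, M n x ∂(ν + ξ.singularPart ν) - c := sub_pos.2 (EReal.coe_lt_coe_iff.1 hn)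
  obtain ⟨d, hd, hdM⟩ := exists_dualPairs_close_partialSups h.measurable_left h.measurable_right
    hpi hqi hs n (ENNReal.ofReal_pos.2 (half_pos hgap)).ne'
  refine ⟨d, hd, ?_⟩
  have hMi : Integrable (M n) (ν + ξ.singularPart ν) :=
    integrable_partialSups (fun i => (hpi.const_mul _).sub (hqi.const_mul _)) n
  have hdi : Integrable (fun x => d.1 x * p x - d.2 x * q x) (ν + ξ.singularPart ν) :=
    (integrable_continuousMap_mul d.1 hpi).sub (integrable_continuousMap_mul d.2 hqi)
  have hle := (enorm_integral_le_lintegral_enorm _).trans hdM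
  rw [integral_sub hMi hdi, h.integral_mul_sub_mul, Real.enorm_eq_ofReal_abs,
    ENNReal.ofReal_le_ofReal_iff (half_pos hgap).le] at hle
  linarith [le_abs_self (∫ x, M n x ∂(ν + ξ.singularPart ν) - (∫ x, d.1 x ∂ξ - ∫ x, d.2 x ∂ν))]

end Variational

theorem fDiv_self {X : Type*} [MeasurableSpace X] {φ : ℝ → EReal} (hφ : φ 1 = 0) (ν : Measure X)
    [SigmaFinite ν] : fDiv φ ν ν = 0 := by
  have h : ∀ᵐ x ∂ν, φ (ν.rnDeriv ν x).toReal = 0 := by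
    filter_upwards [ν.rnDeriv_self] with x hx
    simp only [hx, ENNReal.toReal_one, hφ]
  have hint : eintegral ν (fun x => φ (ν.rnDeriv ν x).toReal) = eintegral ν fun _ => 0 :=
    le_antisymm (eintegral_mono_ae (h.mono fun _ hx => hx.le))
      (eintegral_mono_ae (h.mono fun _ hx => hx.ge))
  rw [fDiv, hint, eintegral_const, Measure.singularPart_self]
  simp

section Semicontinuity

variable {X : Type*} [TopologicalSpace X] [CompactSpace X] [MeasurableSpace X] [BorelSpace X]
  {φ : ℝ → EReal}

theorem IsClosedConvex.fDiv_ne_bot (hφ : IsClosedConvex φ) (ξ ν : Measure X)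
    [IsFiniteMeasure ξ] [IsFiniteMeasure ν] : fDiv φ ξ ν ≠ ⊥ := by
  obtain ⟨p, hp⟩ := hφ.affineMinorants_nonempty
  exact ne_bot_of_le_ne_bot (EReal.coe_ne_bot _) (coe_integral_sub_integral_le_fDiv
    (d := (ContinuousMap.const X p.1, ContinuousMap.const X p.2)) fun _ => hp)

theorem IsClosedConvex.lowerSemicontinuous_fDiv [TopologicalSpace.PseudoMetrizableSpace X]
    (hφ : IsClosedConvex φ) (ν : Measure X) [IsFiniteMeasure ν] :
    LowerSemicontinuous fun ξ : ProbabilityMeasure X => fDiv φ (ξ : Measure X) ν := by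
  intro ξ y hy
  obtain ⟨c, hyc, hc⟩ := EReal.lt_iff_exists_real_btwn.1 hy
  obtain ⟨d, hd, hcd⟩ := hφ.exists_dualPairs_gt hc
  have hcont : Continuous fun ξ : ProbabilityMeasure X =>
      ∫ x, d.1 x ∂(ξ : Measure X) - ∫ x, d.2 x ∂ν :=
    (ProbabilityMeasure.continuous_integral_continuousMap d.1).sub continuous_const
  filter_upwards [hcont.continuousAt.eventually_const_lt hcd] with ξ' hξ'
  exact hyc.trans ((EReal.coe_lt_coe_iff.2 hξ').trans_le (coe_integral_sub_integral_le_fDiv hd))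

end Semicontinuity

theorem isClosed_setOf_map_eq {Y Z : Type*} [TopologicalSpace Y] [MeasurableSpace Y]
    [OpensMeasurableSpace Y] [TopologicalSpace Z] [MeasurableSpace Z] [BorelSpace Z]
    [HasOuterApproxClosed Z] {g : Y → Z} (hg : Continuous g) (ξ : ProbabilityMeasure Z) :
    IsClosed {π : ProbabilityMeasure Y | (π : Measure Y).map g = ξ} := by
  have hset : {π : ProbabilityMeasure Y | (π : Measure Y).map g = ξ}
      = {π | π.map hg.measurable.aemeasurable = ξ} := by
    ext π
    simp only [Set.mem_ofPred_eq, ← ProbabilityMeasure.toMeasure_injective.eq_iff,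
      ProbabilityMeasure.toMeasure_map]
  rw [hset]
  exact isClosed_eq (ProbabilityMeasure.continuous_map hg) continuous_const

section Marginals

variable {X : Type*} [MeasurableSpace X] {f : X → ℝ}

theorem integral_fst_of_measurable (hf : Measurable f) (π : Measure (X × X)) :
    ∫ x, f x ∂π.fst = ∫ z, f z.1 ∂π :=
  integral_map measurable_fst.aemeasurable hf.aestronglyMeasurable

theorem integral_snd_of_measurable (hf : Measurable f) (π : Measure (X × X)) :
    ∫ x, f x ∂π.snd = ∫ z, f z.2 ∂π :=
  integral_map measurable_snd.aemeasurable hf.aestronglyMeasurable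

end Marginals

section TransportPlans

variable {X : Type*} [MeasurableSpace X]

/-- The transport plans with first marginal `μ` and arbitrary second marginal. -/
def plansFrom (μ : ProbabilityMeasure X) : Set (ProbabilityMeasure (X × X)) :=
  {π | (π : Measure (X × X)).fst = μ}

theorem exists_mem_plansFrom_snd_eq (μ ξ : ProbabilityMeasure X) :
    ∃ π ∈ plansFrom μ, (π : Measure (X × X)).snd = ξ :=
  ⟨⟨(μ : Measure X).prod ξ, inferInstance⟩, Measure.fst_prod, Measure.snd_prod⟩

variable [MetricSpace X]

/-- The cost `∫ d(x, y) dπ(x, y)` of a transport plan. It is a genuine integral because `X` is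
compact wherever the cost is used. -/
def transportCost (π : Measure (X × X)) : ℝ := ∫ z, dist z.1 z.2 ∂π

theorem transportCost_nonneg (π : Measure (X × X)) : 0 ≤ transportCost π :=
  integral_nonneg fun _ => dist_nonneg

/-- The Moreau-Yosida functional on transport plans: the divergence of the second marginal plus a
penalty `ℓ` on the transport cost. -/
def planObjective (φ : ℝ → EReal) (ℓ : ℝ → ℝ) (ν : Measure X) (π : ProbabilityMeasure (X × X)) :
    EReal :=
  fDiv φ (π : Measure (X × X)).snd ν + (ℓ (transportCost (π : Measure (X × X))) : EReal)

variable [CompactSpace X] [BorelSpace X]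

theorem isCompact_plansFrom (μ : ProbabilityMeasure X) : IsCompact (plansFrom μ) :=
  (isClosed_setOf_map_eq (Y := X × X) continuous_fst μ).isCompact

theorem integrable_dist (π : Measure (X × X)) [IsFiniteMeasure π] :
    Integrable (fun z : X × X => dist z.1 z.2) π :=
  integrable_continuousMap ⟨_, continuous_dist⟩ π

theorem lintegral_edist_eq_ofReal_transportCost (π : Measure (X × X)) [IsFiniteMeasure π] :
    ∫⁻ z, edist z.1 z.2 ∂π = ENNReal.ofReal (transportCost π) := by
  simp only [edist_dist, transportCost]
  exact (ofReal_integral_eq_lintegral_ofReal (integrable_dist π)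
    (ae_of_all _ fun _ => dist_nonneg)).symm

theorem continuous_transportCost :
    Continuous fun π : ProbabilityMeasure (X × X) => transportCost (π : Measure (X × X)) :=
  ProbabilityMeasure.continuous_integral_continuousMap
    (⟨fun z => dist z.1 z.2, continuous_dist⟩ : C(X × X, ℝ))

theorem exists_optimal_plan (μ ξ : ProbabilityMeasure X) :
    ∃ π ∈ plansFrom μ, (π : Measure (X × X)).snd = ξ ∧
      W₁ (μ : Measure X) ξ = ENNReal.ofReal (transportCost (π : Measure (X × X))) := by
  have hcompact : IsCompact (plansFrom μ ∩ {π | (π : Measure (X × X)).snd = ξ}) :=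
    (isCompact_plansFrom μ).inter_right (isClosed_setOf_map_eq (Y := X × X) continuous_snd ξ)
  obtain ⟨π, hπ, hmin⟩ := hcompact.exists_isMinOn (exists_mem_plansFrom_snd_eq μ ξ)
    continuous_transportCost.continuousOn
  refine ⟨π, hπ.1, hπ.2, le_antisymm ?_ (le_iInf₂ fun ρ hρ => ?_)⟩
  · rw [← lintegral_edist_eq_ofReal_transportCost]
    exact iInf₂_le (π : Measure (X × X)) hπ
  · have : IsProbabilityMeasure (ρ.map Prod.fst) := hρ.1 ▸ inferInstance
    have hprob : IsProbabilityMeasure ρ := Measure.isProbabilityMeasure_of_map Prod.fst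
    rw [lintegral_edist_eq_ofReal_transportCost]
    exact ENNReal.ofReal_le_ofReal (hmin (a := ⟨ρ, hprob⟩) hρ)

theorem integral_sub_integral_le_mul_transportCost {K : NNReal} {f : X → ℝ} (hf : LipschitzWith K f)
    (π : Measure (X × X)) [IsFiniteMeasure π] :
    ∫ x, f x ∂π.fst - ∫ x, f x ∂π.snd ≤ K * transportCost π := by
  have hfst : Integrable (fun z : X × X => f z.1) π :=
    integrable_continuousMap ⟨_, hf.continuous.comp continuous_fst⟩ π
  have hsnd : Integrable (fun z : X × X => f z.2) π :=
    integrable_continuousMap ⟨_, hf.continuous.comp continuous_snd⟩ π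
  rw [integral_fst_of_measurable hf.continuous.measurable,
    integral_snd_of_measurable hf.continuous.measurable, ← integral_sub hfst hsnd, transportCost,
    ← integral_const_mul]
  exact integral_mono (hfst.sub hsnd) ((integrable_dist π).const_mul K) fun z =>
    (le_abs_self _).trans (hf.dist_le_mul z.1 z.2)

end TransportPlans

section PrimalProblem

variable {X : Type*} [MetricSpace X] [CompactSpace X] [MeasurableSpace X] [BorelSpace X]
  {φ : ℝ → EReal}

theorem IsClosedConvex.lowerSemicontinuous_planObjective (hφ : IsClosedConvex φ) {ℓ : ℝ → ℝ}
    (hℓ : Continuous ℓ) (ν : Measure X) [IsFiniteMeasure ν] :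
    LowerSemicontinuous (planObjective φ ℓ ν) := by
  have hdiv : LowerSemicontinuous fun π : ProbabilityMeasure (X × X) =>
      fDiv φ (π : Measure (X × X)).snd ν := by
    simpa only [Function.comp_def, ProbabilityMeasure.toMeasure_map, Measure.snd] using
      (hφ.lowerSemicontinuous_fDiv ν).comp
        (ProbabilityMeasure.continuous_map (Ω := X × X) continuous_snd)
  have hcost : LowerSemicontinuous fun π : ProbabilityMeasure (X × X) =>
      (ℓ (transportCost (π : Measure (X × X))) : EReal) :=
    (continuous_coe_real_ereal.comp (hℓ.comp continuous_transportCost)).lowerSemicontinuous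
  exact hdiv.add' hcost fun π =>
    EReal.continuousAt_add (Or.inr (EReal.coe_ne_bot _)) (Or.inr (EReal.coe_ne_top _))

theorem IsClosedConvex.exists_isLeast_planObjective (hφ : IsClosedConvex φ) (hφ1 : φ 1 = 0)
    {ℓ : ℝ → ℝ} (hℓ : Continuous ℓ) (μ ν : ProbabilityMeasure X) :
    ∃ c : ℝ, IsLeast (planObjective φ ℓ (ν : Measure X) '' plansFrom μ) c := by
  obtain ⟨π₀, hπ₀, hν⟩ := exists_mem_plansFrom_snd_eq μ ν
  obtain ⟨π, hπ, hmin⟩ := LowerSemicontinuousOn.exists_isMinOn ⟨π₀, hπ₀⟩ (isCompact_plansFrom μ)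
    ((hφ.lowerSemicontinuous_planObjective hℓ (ν : Measure X)).lowerSemicontinuousOn _)
  have hbot : planObjective φ ℓ (ν : Measure X) π ≠ ⊥ := by
    rw [planObjective, ne_eq, EReal.add_eq_bot_iff, not_or]
    exact ⟨hφ.fDiv_ne_bot _ _, EReal.coe_ne_bot _⟩
  have htop : planObjective φ ℓ (ν : Measure X) π ≠ ⊤ := by
    refine ne_top_of_le_ne_top ?_ (hmin hπ₀)
    rw [planObjective, hν, fDiv_self hφ1, zero_add]
    exact EReal.coe_ne_top _
  refine ⟨(planObjective φ ℓ (ν : Measure X) π).toReal, ?_⟩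
  rw [EReal.coe_toReal htop hbot]
  exact ⟨⟨π, hπ, rfl⟩, Set.forall_mem_image.2 fun _ h => hmin h⟩

theorem coe_ofReal_mul_rpow {lam α w : ℝ} (hlam : 0 ≤ lam) (hα : 0 ≤ α) (hw : 0 ≤ w) :
    ((ENNReal.ofReal lam * ENNReal.ofReal w ^ α : ℝ≥0∞) : EReal) = ((lam * w ^ α : ℝ) : EReal) := by
  rw [ENNReal.ofReal_rpow_of_nonneg hw hα, ← ENNReal.ofReal_mul hlam, EReal.coe_ennreal_ofReal,
    max_eq_left (mul_nonneg hlam (Real.rpow_nonneg hw α))]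

theorem isLeast_range_primalObjective {lam α : ℝ} (hlam : 0 ≤ lam) (hα : 0 ≤ α)
    {μ : ProbabilityMeasure X} {ν : Measure X} {c : EReal}
    (hc : IsLeast (planObjective φ (fun w => lam * w ^ α) ν '' plansFrom μ) c) :
    IsLeast (Set.range (primalObjective φ lam α (μ : Measure X) ν)) c := by
  have hle : ∀ ξ, c ≤ primalObjective φ lam α (μ : Measure X) ν ξ := fun ξ => by
    obtain ⟨π, hπ, hξ, hW⟩ := exists_optimal_plan μ ξ
    rw [primalObjective, hW, coe_ofReal_mul_rpow hlam hα (transportCost_nonneg _), ← hξ]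
    exact hc.2 (Set.mem_image_of_mem _ hπ)
  obtain ⟨π, hπ, hπc⟩ := hc.1
  refine ⟨⟨π.map measurable_snd.aemeasurable, le_antisymm ?_ (hle _)⟩, Set.forall_mem_range.2 hle⟩
  rw [← hπc, planObjective, ← coe_ofReal_mul_rpow hlam hα (transportCost_nonneg _),
    ← lintegral_edist_eq_ofReal_transportCost, primalObjective]
  refine add_le_add le_rfl (EReal.coe_ennreal_le_coe_ennreal_iff.2 ?_)
  gcongr
  exact iInf₂_le _ ⟨hπ, rfl⟩

end PrimalProblem

/-- The penalty `ℓ` on `[0, ∞)` is the conjugate of the convex function `N` on the set `R` of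
slopes: `ℓ w = max {r w - N r | r ∈ R}`. This treats both exponents `α = 1` and `α > 1` at once. -/
structure IsConjugatePenalty (ℓ : ℝ → ℝ) (R : Set ℝ) (N : ℝ → ℝ) : Prop where
  isClosed : IsClosed R
  nonneg : ∀ r ∈ R, 0 ≤ r
  convexOn : ConvexOn ℝ R N
  continuous : Continuous N
  young : ∀ r ∈ R, ∀ w : ℝ, 0 ≤ w → r * w - N r ≤ ℓ w
  exists_eq : ∀ w : ℝ, 0 ≤ w → ∃ r ∈ R, r * w - N r = ℓ w

theorem isConjugatePenalty_mul_rpow_one {lam : ℝ} (hlam : 0 ≤ lam) :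
    IsConjugatePenalty (fun w => lam * w ^ (1 : ℝ)) {lam} fun _ => 0 where
  isClosed := isClosed_singleton
  nonneg := by rintro _ rfl; exact hlam
  convexOn := convexOn_const 0 (convex_singleton lam)
  continuous := continuous_const
  young := by rintro _ rfl w -; simp
  exists_eq w _ := ⟨lam, rfl, by simp⟩

/-- The coefficient of `r ^ (α / (α - 1))` in the conjugate of `w ↦ lam * w ^ α`. -/
def conjCoeff (lam α : ℝ) : ℝ := (α - 1) * α ^ (α / (1 - α)) * lam ^ (1 / (1 - α))

section Power

variable {lam α : ℝ}

theorem conjCoeff_nonneg (hlam : 0 ≤ lam) (hα : 1 ≤ α) : 0 ≤ conjCoeff lam α := by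
  have : 0 ≤ α - 1 := sub_nonneg.2 hα
  have : 0 ≤ α := by linarith
  unfold conjCoeff
  positivity

theorem monotoneOn_conjCoeff_mul_rpow (hlam : 0 ≤ lam) (hα : 1 ≤ α) :
    MonotoneOn (fun r => conjCoeff lam α * r ^ (α / (α - 1))) (Set.Ici 0) := fun _ hr _ _ hrs =>
  mul_le_mul_of_nonneg_left
    (Real.rpow_le_rpow hr hrs (div_nonneg (by linarith) (sub_nonneg.2 hα)))
    (conjCoeff_nonneg hlam hα)

theorem rpow_sub_one_rpow_div {w : ℝ} (hw : 0 ≤ w) (hα : α ≠ 1) :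
    (w ^ (α - 1)) ^ (α / (α - 1)) = w ^ α := by
  rw [← Real.rpow_mul hw, mul_div_cancel₀ _ (sub_ne_zero.2 hα)]

theorem conjCoeff_mul_rpow (hlam : 0 < lam) (hα : 1 < α) {w : ℝ} (hw : 0 ≤ w) :
    conjCoeff lam α * (lam * α * w ^ (α - 1)) ^ (α / (α - 1)) = (α - 1) * lam * w ^ α := by
  have hα0 : 0 < α := by linarith
  have : α - 1 ≠ 0 := by linarith
  have : 1 - α ≠ 0 := by linarith
  have hαpow : α ^ (α / (1 - α)) * α ^ (α / (α - 1)) = 1 := by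
    rw [← Real.rpow_add hα0, show α / (1 - α) + α / (α - 1) = 0 by grind, Real.rpow_zero]
  have hlampow : lam ^ (1 / (1 - α)) * lam ^ (α / (α - 1)) = lam := by
    rw [← Real.rpow_add hlam, show 1 / (1 - α) + α / (α - 1) = 1 by grind, Real.rpow_one]
  rw [conjCoeff, Real.mul_rpow (by positivity) (by positivity), Real.mul_rpow hlam.le hα0.le,
    rpow_sub_one_rpow_div hw hα.ne']
  calc (α - 1) * α ^ (α / (1 - α)) * lam ^ (1 / (1 - α))
        * (lam ^ (α / (α - 1)) * α ^ (α / (α - 1)) * w ^ α)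
      = (α - 1) * (α ^ (α / (1 - α)) * α ^ (α / (α - 1)))
        * (lam ^ (1 / (1 - α)) * lam ^ (α / (α - 1))) * w ^ α := by ring
    _ = (α - 1) * lam * w ^ α := by rw [hαpow, hlampow, mul_one]

theorem mul_rpow_sub_one_mul_le (hα : 1 < α) {v w : ℝ} (hv : 0 ≤ v) (hw : 0 ≤ w) :
    α * v ^ (α - 1) * w ≤ (α - 1) * v ^ α + w ^ α := by
  have : 0 < α := by linarith
  have : 0 < α - 1 := by linarith
  have hyoung := Real.young_inequality_of_nonneg hw (Real.rpow_nonneg hv (α - 1))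
    (Real.HolderConjugate.conjExponent hα)
  rw [Real.conjExponent, rpow_sub_one_rpow_div hv hα.ne'] at hyoung
  calc α * v ^ (α - 1) * w = α * (w * v ^ (α - 1)) := by ring
    _ ≤ α * (w ^ α / α + v ^ α / (α / (α - 1))) := by gcongr
    _ = (α - 1) * v ^ α + w ^ α := by field_simp; ring

theorem mul_sub_conjCoeff_mul_rpow_le (hlam : 0 < lam) (hα : 1 < α) {r w : ℝ} (hr : 0 ≤ r)
    (hw : 0 ≤ w) : r * w - conjCoeff lam α * r ^ (α / (α - 1)) ≤ lam * w ^ α := by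
  have : 0 < α := by linarith
  obtain ⟨v, hv, rfl⟩ : ∃ v, 0 ≤ v ∧ lam * α * v ^ (α - 1) = r := by
    refine ⟨(r / (lam * α)) ^ (α - 1)⁻¹, by positivity, ?_⟩
    rw [Real.rpow_inv_rpow (by positivity) (by linarith), mul_div_cancel₀ _ (by positivity)]
  rw [conjCoeff_mul_rpow hlam hα hv]
  linarith [mul_le_mul_of_nonneg_left (mul_rpow_sub_one_mul_le hα hv hw) hlam.le]

theorem isConjugatePenalty_mul_rpow (hlam : 0 < lam) (hα : 1 < α) :
    IsConjugatePenalty (fun w => lam * w ^ α) (Set.Ici 0)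
      fun r => conjCoeff lam α * r ^ (α / (α - 1)) where
  isClosed := isClosed_Ici
  nonneg _ hr := hr
  convexOn := (convexOn_rpow (by rw [le_div_iff₀ (by linarith)]; linarith)).smul
    (conjCoeff_nonneg hlam.le hα.le)
  continuous := continuous_const.mul
    (Real.continuous_rpow_const (div_nonneg (by linarith) (by linarith)))
  young _ hr _ hw := mul_sub_conjCoeff_mul_rpow_le hlam hα hr hw
  exists_eq w hw := by
    have : 0 < α := by linarith
    have hpow : w ^ (α - 1) * w = w ^ α := by
      rw [← Real.rpow_add_one' hw (by linarith), sub_add_cancel]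
    refine ⟨lam * α * w ^ (α - 1), Set.mem_Ici.2 (by positivity), ?_⟩
    rw [conjCoeff_mul_rpow hlam hα hw, mul_assoc (lam * α), hpow]
    ring

end Power

theorem exists_lipschitzWith_between {X : Type*} [PseudoMetricSpace X] {K : NNReal} {k h : X → ℝ}
    (hkh : ∀ x y, k x ≤ h y + K * dist x y) :
    ∃ g : X → ℝ, LipschitzWith K g ∧ (∀ x, k x ≤ g x) ∧ ∀ x, g x ≤ h x := by
  have hbdd : ∀ x, BddBelow (Set.range fun y => h y + K * dist x y) := fun x =>
    ⟨k x, Set.forall_mem_range.2 (hkh x)⟩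
  refine ⟨fun x => ⨅ y, (h y + K * dist x y), LipschitzWith.of_le_add_mul K fun x y => ?_,
    fun x => ?_, fun x => ?_⟩
  · have : Nonempty X := ⟨x⟩
    rw [← sub_le_iff_le_add]
    refine le_ciInf fun z => ?_
    have hx : ⨅ y, (h y + K * dist x y) ≤ h z + K * dist x z := ciInf_le (hbdd x) z
    have htri := mul_le_mul_of_nonneg_left (dist_triangle x y z) K.2
    simp only [NNReal.val_eq_coe, mul_add] at htri
    linarith
  · have : Nonempty X := ⟨x⟩
    exact le_ciInf (hkh x)
  · simpa using ciInf_le (hbdd x) x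

theorem exists_probabilityMeasure_mix {Z : Type*} [TopologicalSpace Z] [CompactSpace Z]
    [MeasurableSpace Z] [BorelSpace Z] (π π' : ProbabilityMeasure Z) {a b : ℝ} (ha : 0 ≤ a)
    (hb : 0 ≤ b) (hab : a + b = 1) : ∃ ρ : ProbabilityMeasure Z, ∀ f : C(Z, ℝ),
      ∫ z, f z ∂(ρ : Measure Z)
        = a * ∫ z, f z ∂(π : Measure Z) + b * ∫ z, f z ∂(π' : Measure Z) := by
  refine ⟨⟨ENNReal.ofReal a • (π : Measure Z) + ENNReal.ofReal b • (π' : Measure Z), ⟨?_⟩⟩,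
    fun f => ?_⟩
  · simp [← ENNReal.ofReal_add ha hb, hab]
  · rw [ProbabilityMeasure.coe_mk, integral_add_measure
      ((integrable_continuousMap f _).smul_measure ENNReal.ofReal_ne_top)
      ((integrable_continuousMap f _).smul_measure ENNReal.ofReal_ne_top),
      integral_smul_measure, integral_smul_measure, ENNReal.toReal_ofReal ha,
      ENNReal.toReal_ofReal hb, smul_eq_mul, smul_eq_mul]

theorem exists_integral_ne_of_ne {X : Type*} [TopologicalSpace X] [HasOuterApproxClosed X]
    [MeasurableSpace X] [BorelSpace X] {ξ ξ' : Measure X} [IsFiniteMeasure ξ] [IsFiniteMeasure ξ']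
    (h : ξ ≠ ξ') : ∃ k : C(X, ℝ), ∫ x, k x ∂ξ ≠ ∫ x, k x ∂ξ' := by
  by_contra! hk
  exact h (ext_of_forall_integral_eq_of_IsFiniteMeasure fun f => hk f.toContinuousMap)

section Lagrangian

variable {X : Type*} [MetricSpace X] [MeasurableSpace X]

/-- The Lagrangian of the transport formulation, for a plan `π` and dual variables
`v = ((h, ψ), (k, r))`: the pair `(h, ψ)` represents the divergence, `k` is the multiplier of the
constraint that `π` starts at `μ`, and `r` represents the penalty on the transport cost. -/
def lagrangian (N : ℝ → ℝ) (μ ν : Measure X) (π : Measure (X × X))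
    (v : (C(X, ℝ) × C(X, ℝ)) × (C(X, ℝ) × ℝ)) : ℝ :=
  (∫ x, v.1.1 x ∂π.snd - ∫ x, v.1.2 x ∂ν) + (∫ x, v.2.1 x ∂μ - ∫ x, v.2.1 x ∂π.fst)
    + (v.2.2 * transportCost π - N v.2.2)

/-- The dual variables of the Lagrangian. -/
def multipliers (φ : ℝ → EReal) (R : Set ℝ) : Set ((C(X, ℝ) × C(X, ℝ)) × (C(X, ℝ) × ℝ)) :=
  dualPairs X φ ×ˢ (Set.univ ×ˢ R)

variable [BorelSpace X] {φ : ℝ → EReal} {R : Set ℝ} {N : ℝ → ℝ}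

theorem IsClosedConvex.exists_lt_lagrangian_of_notMem (hφ : IsClosedConvex φ) {r : ℝ} (hr : r ∈ R)
    {μ : ProbabilityMeasure X} (ν : Measure X) {π : ProbabilityMeasure (X × X)}
    (hπ : π ∉ plansFrom μ) (c : ℝ) : ∃ v ∈ multipliers φ R, c < lagrangian N μ ν π v := by
  obtain ⟨k, hk⟩ := exists_integral_ne_of_ne (Ne.symm hπ)
  obtain ⟨p, hp⟩ := hφ.affineMinorants_nonempty
  let d : C(X, ℝ) × C(X, ℝ) := (ContinuousMap.const X p.1, ContinuousMap.const X p.2)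
  let A := lagrangian N μ ν π (d, (0, r))
  let δ := ∫ x, k x ∂(μ : Measure X) - ∫ x, k x ∂(π : Measure (X × X)).fst
  have hscale (s : ℝ) : lagrangian N μ ν π (d, (s • k, r)) = A + s * δ := by
    simp only [A, δ, lagrangian, ContinuousMap.zero_apply, integral_zero,
      ContinuousMap.smul_apply, smul_eq_mul, integral_const_mul]
    ring
  refine ⟨(d, (((c + 1 - A) / δ) • k, r)), ⟨fun _ => hp, Set.mem_univ _, hr⟩, ?_⟩
  rw [hscale, div_mul_cancel₀ _ (sub_ne_zero.2 hk)]
  linarith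

variable [CompactSpace X]

theorem integral_smul_add_smul (ξ : Measure X) [IsFiniteMeasure ξ] (a b : ℝ) (f g : C(X, ℝ)) :
    ∫ x, (a • f + b • g) x ∂ξ = a * ∫ x, f x ∂ξ + b * ∫ x, g x ∂ξ := by
  rw [← integral_const_mul, ← integral_const_mul]
  exact integral_add ((integrable_continuousMap f ξ).const_mul a)
    ((integrable_continuousMap g ξ).const_mul b)

theorem concaveOn_lagrangian (hN : ConvexOn ℝ R N) (μ ν : Measure X) [IsFiniteMeasure μ]
    [IsFiniteMeasure ν] (π : Measure (X × X)) [IsFiniteMeasure π] :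
    ConcaveOn ℝ (multipliers φ R) (lagrangian N μ ν π) := by
  refine ⟨(convex_dualPairs X φ).prod (convex_univ.prod hN.1), fun v hv w hw a b ha hb hab => ?_⟩
  have hNle := hN.2 hv.2.2 hw.2.2 ha hb hab
  simp only [lagrangian, Prod.fst_add, Prod.snd_add, Prod.smul_fst, Prod.smul_snd,
    integral_smul_add_smul, smul_eq_mul] at hNle ⊢
  linarith

/-- The integrand of the Lagrangian, as a function on `X × X`. -/
def lagrangianIntegrand (v : (C(X, ℝ) × C(X, ℝ)) × (C(X, ℝ) × ℝ)) : C(X × X, ℝ) where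
  toFun z := v.1.1 z.2 + v.2.2 * dist z.1 z.2 - v.2.1 z.1

theorem lagrangian_eq_integral_add (N : ℝ → ℝ) (μ ν : Measure X) (π : Measure (X × X))
    [IsFiniteMeasure π] (v : (C(X, ℝ) × C(X, ℝ)) × (C(X, ℝ) × ℝ)) :
    lagrangian N μ ν π v = ∫ z, lagrangianIntegrand v z ∂π
      + (∫ x, v.2.1 x ∂μ - ∫ x, v.1.2 x ∂ν - N v.2.2) := by
  have hfst : Integrable (fun z : X × X => v.2.1 z.1) π :=
    integrable_continuousMap (v.2.1.comp ContinuousMap.fst) π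
  have hsnd : Integrable (fun z : X × X => v.1.1 z.2) π :=
    integrable_continuousMap (v.1.1.comp ContinuousMap.snd) π
  have hdist := (integrable_dist π).const_mul v.2.2
  have hsplit : ∫ z, lagrangianIntegrand v z ∂π
      = ∫ z, v.1.1 z.2 ∂π + v.2.2 * ∫ z, dist z.1 z.2 ∂π - ∫ z, v.2.1 z.1 ∂π := by
    rw [← integral_const_mul, ← integral_add hsnd hdist]
    exact integral_sub (hsnd.add hdist) hfst
  rw [hsplit, lagrangian, integral_fst_of_measurable v.2.1.continuous.measurable,
    integral_snd_of_measurable v.1.1.continuous.measurable, transportCost]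
  ring

theorem IsClosedConvex.exists_lt_lagrangian (hφ : IsClosedConvex φ) {ℓ : ℝ → ℝ}
    (hN : IsConjugatePenalty ℓ R N) {μ : ProbabilityMeasure X} {ν : Measure X} [IsFiniteMeasure ν]
    {π : ProbabilityMeasure (X × X)} {c : ℝ} (hc : (c : EReal) < planObjective φ ℓ ν π) :
    ∃ v ∈ multipliers φ R, c < lagrangian N μ ν π v := by
  obtain ⟨r, hr, hrℓ⟩ := hN.exists_eq _ (transportCost_nonneg (π : Measure (X × X)))
  have hdiv : ((c - ℓ (transportCost (π : Measure (X × X))) : ℝ) : EReal)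
      < fDiv φ (π : Measure (X × X)).snd ν := by
    rw [EReal.coe_sub]
    exact (EReal.sub_lt_iff (Or.inl (EReal.coe_ne_bot _)) (Or.inl (EReal.coe_ne_top _))).2 hc
  obtain ⟨d, hd, hcd⟩ := hφ.exists_dualPairs_gt hdiv
  refine ⟨(d, (0, r)), ⟨hd, Set.mem_univ _, hr⟩, ?_⟩
  simp only [lagrangian, ContinuousMap.zero_apply, integral_zero]
  linarith

-- The minimax theorem is applied over all plans, with the condition `π.fst = μ` dualised; the
-- resulting multiplier is good on every plan, in particular on the Dirac masses of `X × X`.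
theorem IsClosedConvex.exists_potential_le (hφ : IsClosedConvex φ) {ℓ : ℝ → ℝ}
    (hN : IsConjugatePenalty ℓ R N) {μ : ProbabilityMeasure X} {ν : Measure X} [IsFiniteMeasure ν]
    {c : ℝ} (hc : ∀ π ∈ plansFrom μ, (c : EReal) < planObjective φ ℓ ν π) :
    ∃ d ∈ dualPairs X φ, ∃ r ∈ R, ∃ k : C(X, ℝ), (∀ x y, k x ≤ d.1 y + r * dist x y) ∧
      ∫ x, k x ∂(μ : Measure X) - ∫ x, d.2 x ∂ν - N r = c := by
  have hne : Nonempty (ProbabilityMeasure (X × X)) :=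
    ⟨⟨(μ : Measure X).prod μ, inferInstance⟩⟩
  obtain ⟨v, ⟨hd, -, hr⟩, hv⟩ := exists_forall_lt_of_forall_exists_lt
    (F := fun π : ProbabilityMeasure (X × X) => lagrangian N μ ν π) (S := multipliers φ R) (c := c)
    (fun v _ => by
      simp only [lagrangian_eq_integral_add]
      exact (ProbabilityMeasure.continuous_integral_continuousMap _).add continuous_const)
    (fun π π' a b ha hb hab => by
      obtain ⟨ρ, hρ⟩ := exists_probabilityMeasure_mix π π' ha hb hab
      refine ⟨ρ, fun v => ?_⟩
      simp only [lagrangian_eq_integral_add, hρ]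
      linear_combination (-(∫ x, v.2.1 x ∂(μ : Measure X) - ∫ x, v.1.2 x ∂ν - N v.2.2)) * hab)
    (fun π => concaveOn_lagrangian hN.convexOn _ _ _)
    (fun π => by
      by_cases hπ : π ∈ plansFrom μ
      · exact hφ.exists_lt_lagrangian hN (hc π hπ)
      · obtain ⟨r, hr, -⟩ := hN.exists_eq 0 le_rfl
        exact hφ.exists_lt_lagrangian_of_notMem hr ν hπ c)
  obtain ⟨⟨h, ψ⟩, k, r⟩ := v
  set C := ∫ x, k x ∂(μ : Measure X) - ∫ x, ψ x ∂ν - N r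
  refine ⟨(h, ψ), hd, r, hr, k + ContinuousMap.const X (c - C), fun x y => ?_, ?_⟩
  · have hdirac := hv ⟨Measure.dirac (x, y), inferInstance⟩
    simp only [lagrangian_eq_integral_add, ProbabilityMeasure.coe_mk, integral_dirac,
      lagrangianIntegrand, ContinuousMap.coe_mk] at hdirac
    simp only [ContinuousMap.add_apply, ContinuousMap.const_apply]
    linarith
  · have hshift : ∫ x, (k + ContinuousMap.const X (c - C)) x ∂(μ : Measure X)
        = ∫ x, k x ∂(μ : Measure X) + (c - C) := by
      simp [integral_add (integrable_continuousMap k _) (integrable_const _)]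
    rw [hshift]
    linarith

end Lagrangian

section ERealSub

variable {a b : ℝ} {D : EReal}

theorem coe_sub_le_coe_iff : (a : EReal) - D ≤ (b : EReal) ↔ ((a - b : ℝ) : EReal) ≤ D := by
  induction D with
  | bot => simp [-EReal.coe_sub]
  | top => simp [-EReal.coe_sub]
  | coe D =>
    simp only [← EReal.coe_sub, EReal.coe_le_coe_iff]
    exact sub_le_comm

theorem coe_le_coe_sub_iff : (b : EReal) ≤ (a : EReal) - D ↔ D ≤ ((a - b : ℝ) : EReal) := by
  induction D with
  | bot => simp [-EReal.coe_sub]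
  | top => simp [-EReal.coe_sub]
  | coe D =>
    simp only [← EReal.coe_sub, EReal.coe_le_coe_iff]
    exact le_sub_comm

end ERealSub

section ContinuousMap

variable {X : Type*}

theorem continuous_integral_continuousMap [TopologicalSpace X] [CompactSpace X] [MeasurableSpace X]
    [BorelSpace X] (ξ : Measure X) [IsFiniteMeasure ξ] :
    Continuous fun f : C(X, ℝ) => ∫ x, f x ∂ξ := by
  refine (LipschitzWith.of_dist_le_mul (K := (ξ Set.univ).toNNReal) fun f g => ?_).continuous
  rw [Real.dist_eq, ← integral_sub (integrable_continuousMap f ξ) (integrable_continuousMap g ξ),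
    ← Real.norm_eq_abs, mul_comm]
  refine norm_integral_le_of_norm_le_const (Eventually.of_forall fun x => ?_)
  rw [← dist_eq_norm]
  exact ContinuousMap.dist_apply_le_dist x

variable [MetricSpace X]

theorem isClosed_setOf_lipschitzWith_toNNReal :
    IsClosed {p : C(X, ℝ) × ℝ | LipschitzWith p.2.toNNReal p.1} := by
  simp only [lipschitzWith_iff_dist_le_mul, Set.ofPred_forall]
  refine isClosed_iInter fun x => isClosed_iInter fun y => isClosed_le ?_ ?_
  · exact ((continuous_eval_const x).comp continuous_fst).dist
      ((continuous_eval_const y).comp continuous_fst)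
  · exact (NNReal.continuous_coe.comp (continuous_real_toNNReal.comp continuous_snd)).mul
      continuous_const

theorem isCompact_setOf_lipschitzWith_eq_zero (K : NNReal) (x₀ : X) :
    IsCompact {f : C(X, ℝ) | LipschitzWith K f ∧ f x₀ = 0} := by
  refine ArzelaAscoli.isCompact_of_equicontinuous _ ?_
    (LipschitzWith.uniformEquicontinuous _ K fun f => f.2.1).equicontinuous
  have himage : ContinuousMap.toFun '' {f : C(X, ℝ) | LipschitzWith K f ∧ f x₀ = 0}
      = {f : X → ℝ | LipschitzWith K f} ∩ {f | f x₀ = 0} := by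
    ext f
    exact ⟨by rintro ⟨f, hf, rfl⟩; exact hf, fun hf => ⟨⟨f, hf.1.continuous⟩, hf, rfl⟩⟩
  rw [himage]
  refine (isCompact_univ_pi fun x =>
    isCompact_closedBall (0 : ℝ) (K * dist x x₀)).of_isClosed_subset ?_ ?_
  · simp only [lipschitzWith_iff_dist_le_mul, Set.ofPred_forall]
    exact (isClosed_iInter fun x => isClosed_iInter fun y => isClosed_le
      ((continuous_apply x).dist (continuous_apply y)) continuous_const).inter
      (isClosed_eq (continuous_apply x₀) continuous_const)
  · rintro f ⟨hf, hf0⟩ x -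
    simpa [show f x₀ = 0 from hf0] using hf.dist_le_mul x x₀

end ContinuousMap

section Dual

variable {X : Type*} [MeasurableSpace X]

/-- The dual functional at a potential `p.1` and a slope `p.2`; `N` is the conjugate of the penalty
on the transport cost. -/
def dualObjective [TopologicalSpace X] (φ : ℝ → EReal) (N : ℝ → ℝ) (μ ν : Measure X)
    (p : C(X, ℝ) × ℝ) : EReal :=
  ((∫ x, p.1 x ∂μ : ℝ) : EReal) - fDivConj φ p.1 ν - (N p.2 : EReal)

/-- The dual variables: a potential vanishing at `x₀`, with a Lipschitz constant taken from `R`.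
For sets `R` of nonnegative slopes the truncation `toNNReal` has no effect. -/
def lipschitzPairs [MetricSpace X] (R : Set ℝ) (x₀ : X) : Set (C(X, ℝ) × ℝ) :=
  {p | p.2 ∈ R ∧ LipschitzWith p.2.toNNReal p.1 ∧ p.1 x₀ = 0}

variable {φ : ℝ → EReal} {N : ℝ → ℝ}

theorem coe_le_dualObjective_iff [TopologicalSpace X] {μ ν : Measure X} {p : C(X, ℝ) × ℝ} {c : ℝ} :
    (c : EReal) ≤ dualObjective φ N μ ν p ↔ ∀ ξ : ProbabilityMeasure X,
      ((c + N p.2 + (∫ x, p.1 x ∂(ξ : Measure X) - ∫ x, p.1 x ∂μ) : ℝ) : EReal)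
        ≤ fDiv φ ξ ν := by
  rw [dualObjective, EReal.le_sub_iff_add_le (Or.inl (EReal.coe_ne_bot _))
    (Or.inl (EReal.coe_ne_top _)), ← EReal.coe_add, coe_le_coe_sub_iff, fDivConj, iSup_le_iff]
  refine forall_congr' fun ξ => ?_
  rw [coe_sub_le_coe_iff]
  ring_nf

variable [MetricSpace X] [CompactSpace X] [BorelSpace X] {ℓ : ℝ → ℝ} {R : Set ℝ} {x₀ : X}

theorem IsClosedConvex.exists_le_dualObjective (hφ : IsClosedConvex φ)
    (hN : IsConjugatePenalty ℓ R N) (x₀ : X) {μ ν : ProbabilityMeasure X} {c : ℝ}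
    (hc : ∀ π ∈ plansFrom μ, (c : EReal) < planObjective φ ℓ ν π) :
    ∃ p ∈ lipschitzPairs R x₀, (c : EReal) ≤ dualObjective φ N μ ν p := by
  obtain ⟨d, hd, r, hr, k, hkd, rfl⟩ := hφ.exists_potential_le hN hc
  obtain ⟨g, hg, hkg, hgd⟩ := exists_lipschitzWith_between (K := r.toNNReal)
    (by simpa only [Real.coe_toNNReal r (hN.nonneg r hr)] using hkd)
  let G : C(X, ℝ) := ⟨g, hg.continuous⟩
  have hshift (ξ : ProbabilityMeasure X) :
      ∫ x, (G - ContinuousMap.const X (g x₀)) x ∂(ξ : Measure X)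
        = ∫ x, G x ∂(ξ : Measure X) - g x₀ := by
    simpa using integral_sub (integrable_continuousMap G (ξ : Measure X))
      (integrable_const (g x₀))
  refine ⟨(G - ContinuousMap.const X (g x₀), r), ⟨hr, ?_, sub_self _⟩,
    coe_le_dualObjective_iff.2 fun ξ => ?_⟩
  · exact LipschitzWith.of_dist_le_mul fun x y => by simpa [G] using hg.dist_le_mul x y
  · refine le_trans (EReal.coe_le_coe_iff.2 ?_) (coe_integral_sub_integral_le_fDiv hd)
    have hGξ : ∫ x, G x ∂(ξ : Measure X) ≤ ∫ x, d.1 x ∂(ξ : Measure X) :=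
      integral_mono (integrable_continuousMap G ξ) (integrable_continuousMap d.1 ξ) hgd
    have hGμ : ∫ x, k x ∂(μ : Measure X) ≤ ∫ x, G x ∂(μ : Measure X) :=
      integral_mono (integrable_continuousMap k μ) (integrable_continuousMap G μ) hkg
    rw [hshift, hshift]
    linarith

theorem integral_sub_integral_le_of_mem_lipschitzPairs {p : C(X, ℝ) × ℝ}
    (hp : p ∈ lipschitzPairs R x₀) (hR : ∀ r ∈ R, 0 ≤ r) {μ : ProbabilityMeasure X}
    {π : ProbabilityMeasure (X × X)} (hπ : π ∈ plansFrom μ) :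
    ∫ x, p.1 x ∂(μ : Measure X) - ∫ x, p.1 x ∂(π : Measure (X × X)).snd
      ≤ p.2 * transportCost (π : Measure (X × X)) := by
  rw [← show (π : Measure (X × X)).fst = μ from hπ]
  simpa only [Real.coe_toNNReal _ (hR _ hp.1)] using
    integral_sub_integral_le_mul_transportCost hp.2.1 (π : Measure (X × X))

theorem IsConjugatePenalty.dualObjective_le_planObjective (hN : IsConjugatePenalty ℓ R N)
    {μ : ProbabilityMeasure X} {ν : Measure X} {p : C(X, ℝ) × ℝ} (hp : p ∈ lipschitzPairs R x₀)
    {π : ProbabilityMeasure (X × X)} (hπ : π ∈ plansFrom μ) :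
    dualObjective φ N μ ν p ≤ planObjective φ ℓ ν π := by
  refine EReal.ge_of_forall_gt_iff_ge.1 fun c hc => ?_
  have hcost := integral_sub_integral_le_of_mem_lipschitzPairs hp hN.nonneg hπ
  have hyoung := hN.young _ hp.1 _ (transportCost_nonneg (π : Measure (X × X)))
  have hdiv : ((c - ℓ (transportCost (π : Measure (X × X))) : ℝ) : EReal)
      ≤ fDiv φ (π : Measure (X × X)).snd ν := by
    refine le_trans (EReal.coe_le_coe_iff.2 ?_)
      (coe_le_dualObjective_iff.1 hc.le ⟨(π : Measure (X × X)).snd, inferInstance⟩)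
    rw [ProbabilityMeasure.coe_mk]
    linarith
  rw [planObjective, ← EReal.sub_le_iff_le_add (Or.inl (EReal.coe_ne_bot _))
    (Or.inl (EReal.coe_ne_top _)), ← EReal.coe_sub]
  exact hdiv

/-- The points of `lipschitzPairs R x₀` where the dual functional is at least `c`. -/
def dualSuperlevel (φ : ℝ → EReal) (R : Set ℝ) (N : ℝ → ℝ) (x₀ : X) (μ ν : Measure X) (c : ℝ) :
    Set (C(X, ℝ) × ℝ) :=
  {p ∈ lipschitzPairs R x₀ | (c : EReal) ≤ dualObjective φ N μ ν p}

theorem IsConjugatePenalty.isClosed_dualSuperlevel (hN : IsConjugatePenalty ℓ R N) (x₀ : X)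
    (μ ν : Measure X) [IsFiniteMeasure μ] (c : ℝ) :
    IsClosed (dualSuperlevel φ R N x₀ μ ν c) := by
  have hpairs : IsClosed (lipschitzPairs R x₀) :=
    (hN.isClosed.preimage continuous_snd).inter (isClosed_setOf_lipschitzWith_toNNReal.inter
      (isClosed_eq ((continuous_eval_const x₀).comp continuous_fst) continuous_const))
  have hvalue : IsClosed {p : C(X, ℝ) × ℝ | (c : EReal) ≤ dualObjective φ N μ ν p} := by
    simp only [coe_le_dualObjective_iff, Set.ofPred_forall]
    refine isClosed_iInter fun ξ => isClosed_Iic.preimage (continuous_coe_real_ereal.comp ?_)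
    exact (continuous_const.add (hN.continuous.comp continuous_snd)).add
      (((continuous_integral_continuousMap _).comp continuous_fst).sub
        ((continuous_integral_continuousMap _).comp continuous_fst))
  exact hpairs.inter hvalue

theorem IsConjugatePenalty.exists_forall_mem_dualSuperlevel_le (hN : IsConjugatePenalty ℓ R N)
    (hφ1 : φ 1 = 0) (x₀ : X) (μ ν : ProbabilityMeasure X) (c : ℝ) :
    ∃ B, ∀ p ∈ dualSuperlevel φ R N x₀ μ ν c, p.2 ≤ B := by
  obtain ⟨π, hπ, hπν⟩ := exists_mem_plansFrom_snd_eq μ ν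
  refine ⟨ℓ (transportCost (π : Measure (X × X)) + 1) - c, fun p ⟨hp, hcp⟩ => ?_⟩
  have hcost := integral_sub_integral_le_of_mem_lipschitzPairs hp hN.nonneg hπ
  have hyoung := hN.young _ hp.1 _
    (add_nonneg (transportCost_nonneg (π : Measure (X × X))) zero_le_one)
  have hν := coe_le_dualObjective_iff.1 hcp ν
  rw [fDiv_self hφ1, ← EReal.coe_zero, EReal.coe_le_coe_iff] at hν
  rw [hπν] at hcost
  linarith

theorem IsConjugatePenalty.isCompact_dualSuperlevel (hN : IsConjugatePenalty ℓ R N)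
    (hφ1 : φ 1 = 0) (x₀ : X) (μ ν : ProbabilityMeasure X) (c : ℝ) :
    IsCompact (dualSuperlevel φ R N x₀ μ ν c) := by
  obtain ⟨B, hB⟩ := hN.exists_forall_mem_dualSuperlevel_le hφ1 x₀ μ ν c
  refine ((isCompact_setOf_lipschitzWith_eq_zero B.toNNReal x₀).prod
    (isCompact_Icc (a := 0) (b := B))).of_isClosed_subset
    (hN.isClosed_dualSuperlevel x₀ μ ν c) fun p hp => ?_
  exact ⟨⟨hp.1.2.1.weaken (Real.toNNReal_le_toNNReal (hB p hp)), hp.1.2.2⟩,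
    hN.nonneg _ hp.1.1, hB p hp⟩

theorem IsClosedConvex.exists_le_dualObjective_of_forall_le (hφ : IsClosedConvex φ)
    (hφ1 : φ 1 = 0) (hN : IsConjugatePenalty ℓ R N) (x₀ : X) {μ ν : ProbabilityMeasure X} {c : ℝ}
    (hc : ∀ π ∈ plansFrom μ, (c : EReal) ≤ planObjective φ ℓ ν π) :
    ∃ p ∈ lipschitzPairs R x₀, (c : EReal) ≤ dualObjective φ N μ ν p := by
  have hanti : Antitone fun b : Set.Iio c => dualSuperlevel φ R N x₀ μ ν b :=
    fun _ _ hbb' _ hp => ⟨hp.1, (EReal.coe_le_coe_iff.2 hbb').trans hp.2⟩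
  obtain ⟨p, hp⟩ := IsCompact.nonempty_iInter_of_directed_nonempty_isCompact_isClosed _
    hanti.directed_ge
    (fun b => hφ.exists_le_dualObjective hN x₀ fun π hπ =>
      (EReal.coe_lt_coe_iff.2 b.2).trans_le (hc π hπ))
    (fun b => hN.isCompact_dualSuperlevel hφ1 x₀ μ ν b)
    (fun b => hN.isClosed_dualSuperlevel x₀ μ ν b)
  have hmem (b : ℝ) (hb : b < c) := Set.mem_iInter.1 hp ⟨b, hb⟩
  exact ⟨p, (hmem (c - 1) (sub_one_lt c)).1, EReal.ge_of_forall_gt_iff_ge.1 fun b hb =>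
    (hmem b (EReal.coe_lt_coe_iff.1 hb)).2⟩

theorem IsClosedConvex.isGreatest_dualObjective (hφ : IsClosedConvex φ) (hφ1 : φ 1 = 0)
    (hN : IsConjugatePenalty ℓ R N) (x₀ : X) {μ ν : ProbabilityMeasure X} {c : ℝ}
    (hc : IsLeast (planObjective φ ℓ ν '' plansFrom μ) c) :
    IsGreatest (dualObjective φ N μ ν '' lipschitzPairs R x₀) c := by
  obtain ⟨⟨π, hπ, hπc⟩, hle⟩ := hc
  have hbound : ∀ p ∈ lipschitzPairs R x₀, dualObjective φ N μ ν p ≤ c := fun p hp =>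
    hπc ▸ hN.dualObjective_le_planObjective hp hπ
  obtain ⟨p, hp, hcp⟩ := hφ.exists_le_dualObjective_of_forall_le hφ1 hN x₀ fun π hπ =>
    hle (Set.mem_image_of_mem _ hπ)
  exact ⟨⟨p, hp, (hbound p hp).antisymm hcp⟩, Set.forall_mem_image.2 hbound⟩

end Dual

section LipNorm

variable {X : Type*} [MetricSpace X] {f : X → ℝ} {R : Set ℝ} {x₀ : X} {r : ℝ}

theorem lipNorm_nonneg (f : X → ℝ) : 0 ≤ lipNorm f :=
  Real.sSup_nonneg (by rintro _ ⟨x, y, -, rfl⟩; positivity)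

theorem lipNorm_le_of_lipschitzWith {K : NNReal} (hf : LipschitzWith K f) : lipNorm f ≤ K := by
  refine Real.sSup_le ?_ K.2
  rintro _ ⟨x, y, hxy, rfl⟩
  exact (div_le_iff₀ (dist_pos.2 hxy)).2 (hf.dist_le_mul x y)

theorem lipschitzWith_toNNReal_lipNorm {K : NNReal} (hf : LipschitzWith K f) :
    LipschitzWith (lipNorm f).toNNReal f := by
  refine LipschitzWith.of_dist_le_mul fun x y => ?_
  rw [Real.coe_toNNReal _ (lipNorm_nonneg f)]
  rcases eq_or_ne x y with rfl | hxy
  · simp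
  · refine (div_le_iff₀ (dist_pos.2 hxy)).1 (le_csSup ⟨K, ?_⟩ ⟨x, y, hxy, rfl⟩)
    rintro _ ⟨a, b, hab, rfl⟩
    exact (div_le_iff₀ (dist_pos.2 hab)).2 (hf.dist_le_mul a b)

theorem exists_mem_lipschitzPairs (hf : f ∈ LipAt x₀) (hfr : lipNorm f ≤ r) (hr : r ∈ R) :
    ∃ g : C(X, ℝ), g = f ∧ (g, r) ∈ lipschitzPairs R x₀ := by
  obtain ⟨⟨K, hK⟩, hf0⟩ := hf
  exact ⟨⟨f, hK.continuous⟩, rfl, hr,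
    (lipschitzWith_toNNReal_lipNorm hK).weaken (Real.toNNReal_le_toNNReal hfr), hf0⟩

theorem mem_lipAt_of_mem_lipschitzPairs {p : C(X, ℝ) × ℝ} (hp : p ∈ lipschitzPairs R x₀) :
    ⇑p.1 ∈ LipAt x₀ :=
  ⟨⟨_, hp.2.1⟩, hp.2.2⟩

theorem lipNorm_le_of_mem_lipschitzPairs {p : C(X, ℝ) × ℝ} (hp : p ∈ lipschitzPairs R x₀)
    (hp0 : 0 ≤ p.2) : lipNorm p.1 ≤ p.2 := by
  simpa only [Real.coe_toNNReal _ hp0] using lipNorm_le_of_lipschitzWith hp.2.1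

end LipNorm

section Potentials

variable {X : Type*} [MetricSpace X] [MeasurableSpace X] {φ : ℝ → EReal} {μ ν : Measure X} {x₀ : X}
  {c : EReal}

theorem isGreatest_image_lipNorm_le {lam : ℝ} (hlam : 0 ≤ lam)
    (h : IsGreatest (dualObjective φ (fun _ => 0) μ ν '' lipschitzPairs {lam} x₀) c) :
    IsGreatest ((fun f : X → ℝ => ((∫ x, f x ∂μ : ℝ) : EReal) - fDivConj φ f ν) ''
      {f | f ∈ LipAt x₀ ∧ lipNorm f ≤ lam}) c := by
  convert h using 1
  refine Set.Subset.antisymm ?_ ?_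
  · rintro _ ⟨f, ⟨hf, hfl⟩, rfl⟩
    obtain ⟨g, rfl, hg⟩ := exists_mem_lipschitzPairs hf hfl (Set.mem_singleton lam)
    exact ⟨_, hg, by simp [dualObjective]⟩
  · rintro _ ⟨p, hp, rfl⟩
    obtain ⟨f, r⟩ := p
    obtain rfl : r = lam := hp.1
    exact ⟨f, ⟨mem_lipAt_of_mem_lipschitzPairs hp, lipNorm_le_of_mem_lipschitzPairs hp hlam⟩,
      by simp [dualObjective]⟩

theorem isGreatest_image_lipAt {N : ℝ → ℝ} (hN : MonotoneOn N (Set.Ici 0))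
    (h : IsGreatest (dualObjective φ N μ ν '' lipschitzPairs (Set.Ici 0) x₀) c) :
    IsGreatest ((fun f : X → ℝ => ((∫ x, f x ∂μ : ℝ) : EReal) - fDivConj φ f ν
      - (N (lipNorm f) : EReal)) '' LipAt x₀) c := by
  have hle : ∀ f ∈ LipAt x₀,
      ((∫ x, f x ∂μ : ℝ) : EReal) - fDivConj φ f ν - (N (lipNorm f) : EReal) ≤ c := fun f hf => by
    obtain ⟨g, rfl, hg⟩ := exists_mem_lipschitzPairs hf le_rfl (lipNorm_nonneg f)
    exact h.2 ⟨_, hg, rfl⟩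
  obtain ⟨⟨f, r⟩, hp, hpc⟩ := h.1
  have hf : ⇑f ∈ LipAt x₀ := mem_lipAt_of_mem_lipschitzPairs hp
  refine ⟨⟨f, hf, (hle f hf).antisymm ?_⟩, Set.forall_mem_image.2 hle⟩
  rw [← hpc]
  exact EReal.sub_le_sub le_rfl (EReal.coe_le_coe_iff.2
    (hN (lipNorm_nonneg f) hp.1 (lipNorm_le_of_mem_lipschitzPairs hp hp.1)))

end Potentials

theorem IsAdmissible.convex_epigraph {φ : ℝ → EReal} (hφ : IsAdmissible φ) :
    Convex ℝ {p : ℝ × ℝ | φ p.1 ≤ p.2} := by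
  rintro ⟨x, y⟩ hxy ⟨x', y'⟩ hxy' a b ha hb hab
  obtain rfl : b = 1 - a := by linarith
  simp only [Set.mem_ofPred_eq, Prod.smul_mk, Prod.mk_add_mk, smul_eq_mul] at *
  refine (hφ.convex x x' a ha (by linarith)).trans ?_
  rw [EReal.coe_add, EReal.coe_mul, EReal.coe_mul]
  exact add_le_add (mul_le_mul_of_nonneg_left hxy (EReal.coe_nonneg.2 ha))
    (mul_le_mul_of_nonneg_left hxy' (EReal.coe_nonneg.2 hb))

end MoreauYosida

end

open MoreauYosida in
theorem proposition3_general {X : Type*} [MetricSpace X] [CompactSpace X] [MeasurableSpace X]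
    [BorelSpace X] (x₀ : X) (μ ν : ProbabilityMeasure X) {lam α : ℝ} (hlam : 0 < lam)
    (hα : 1 ≤ α) {φ : ℝ → EReal} (hconv : Convex ℝ {p : ℝ × ℝ | φ p.1 ≤ p.2})
    (hlsc : LowerSemicontinuous φ) (hφ1 : φ 1 = 0) :
    IsLeast (Set.range (primalObjective φ lam α (μ : Measure X) (ν : Measure X)))
      (myDiv φ lam α (μ : Measure X) (ν : Measure X)) ∧
    (α = 1 →
      IsGreatest
        ((fun f : X → ℝ => ((∫ x, f x ∂(μ : Measure X) : ℝ) : EReal)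
            - fDivConj φ f (ν : Measure X)) '' {f | f ∈ LipAt x₀ ∧ lipNorm f ≤ lam})
        (myDiv φ lam α (μ : Measure X) (ν : Measure X))) ∧
    (1 < α →
      IsGreatest
        ((fun f : X → ℝ => ((∫ x, f x ∂(μ : Measure X) : ℝ) : EReal)
            - fDivConj φ f (ν : Measure X)
            - (((α - 1) * α ^ (α / (1 - α)) * lam ^ (1 / (1 - α))
                * lipNorm f ^ (α / (α - 1)) : ℝ) : EReal)) '' LipAt x₀)
        (myDiv φ lam α (μ : Measure X) (ν : Measure X))) := by
  have hφ : IsClosedConvex φ := ⟨hconv, hlsc, 1, 0, by simpa using hφ1⟩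
  have hα0 : 0 ≤ α := by linarith
  obtain ⟨c, hc⟩ := hφ.exists_isLeast_planObjective hφ1
    (continuous_const.mul (Real.continuous_rpow_const hα0)) μ ν
  have hprimal := isLeast_range_primalObjective hlam.le hα0 hc
  rw [show myDiv φ lam α (μ : Measure X) (ν : Measure X) = c from hprimal.isGLB.sInf_eq]
  refine ⟨hprimal, ?_, fun hα1 => ?_⟩
  · rintro rfl
    exact isGreatest_image_lipNorm_le hlam.le
      (hφ.isGreatest_dualObjective hφ1 (isConjugatePenalty_mul_rpow_one hlam.le) x₀ hc)
  · refine isGreatest_image_lipAt (monotoneOn_conjCoeff_mul_rpow hlam.le hα)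
      (hφ.isGreatest_dualObjective hφ1 (isConjugatePenalty_mul_rpow hlam hα1) x₀ hc)

theorem proposition3 {X : Type*} [MetricSpace X] [CompactSpace X] [MeasurableSpace X]
    [BorelSpace X] (x₀ : X) (μ ν : ProbabilityMeasure X) (lam α : ℝ) (hlam : 0 < lam)
    (hα : 1 ≤ α) (φ : ℝ → EReal) (hφ : MoreauYosida.IsAdmissible φ) :
    -- the infimum that defines `D_{φ,λ,α}(μ‖ν)` is a minimum
    IsLeast (Set.range (MoreauYosida.primalObjective φ lam α (μ : Measure X) (ν : Measure X)))
      (MoreauYosida.myDiv φ lam α (μ : Measure X) (ν : Measure X)) ∧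
    -- the case `α = 1`
    (α = 1 →
      IsGreatest
        ((fun f : X → ℝ => ((∫ x, f x ∂(μ : Measure X) : ℝ) : EReal)
            - MoreauYosida.fDivConj φ f (ν : Measure X)) ''
          {f | f ∈ MoreauYosida.LipAt x₀ ∧ MoreauYosida.lipNorm f ≤ lam})
        (MoreauYosida.myDiv φ lam α (μ : Measure X) (ν : Measure X))) ∧
    -- the case `α > 1`
    (1 < α →
      IsGreatest
        ((fun f : X → ℝ => ((∫ x, f x ∂(μ : Measure X) : ℝ) : EReal)
            - MoreauYosida.fDivConj φ f (ν : Measure X)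
            - (((α - 1) * α ^ (α / (1 - α)) * lam ^ (1 / (1 - α))
                * MoreauYosida.lipNorm f ^ (α / (α - 1)) : ℝ) : EReal)) ''
          MoreauYosida.LipAt x₀)
        (MoreauYosida.myDiv φ lam α (μ : Measure X) (ν : Measure X))) :=
  proposition3_general x₀ μ ν hlam hα hφ.convex_epigraph hφ.lowerSemicontinuous hφ.map_one
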